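/- Let $1\le m\le d$ be integers and let $\mathcal M\subset\mathbb R^d$ be an $m$-dimensional (embedded) $C^\infty$ submanifold. Let $\mathbf X_1,\mathbf X_2,\dots$ be independent random points of $\mathcal M$ with common law $\mu$, and assume that for every smooth chart $(U,\psi)$ of $\mathcal M$, with $U\subset\mathcal M$ open and $\psi:U\to V\subset\mathbb R^m$, the pushforward $\psi_*(\mu|_U)$ is absolutely continuous with respect to the Lebesgue measure on $V$. For $n\ge 2$ let $\mathcal G_n$ be the directed nearest-neighbour graph on the vertices $\{1,\dots,n\}$, with an edge $i\to j$ if $\mathbf X_j$ is the nearest neighbour of $\mathbf X_i$ (in Euclidean distance) among $\{\mathbf X_l : 1\le l\le n,\ l\neq i\}$; ties, if any, are broken by an arbitrary measurable rule, so that every vertex has exactly one outgoing edge. Then, as $n\to\infty$, $$\mathbb E\Big(\frac1n\,\#\big\{(i,j,k)\text{ distinct}: i\to k \text{ and } j\to k \text{ are edges of } \mathcal G_n\big\}\Big)\longrightarrow \mathfrak o_m,$$ where $$\mathfrak o_m:=\iint_{\Gamma_{m;2}}\exp\Big[-\lambda\big\{B(\mathbf w_1,\|\mathbf w_1\|)\cup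 B(\mathbf w_2,\|\mathbf w_2\|)\big\}\Big]\,d(\mathbf w_1,\mathbf w_2)<\infty,$$ $$\Gamma_{m;2}:=\big\{(\mathbf w_1,\mathbf w_2)\in(\mathbb R^m)^2:\max(\|\mathbf w_1\|,\|\mathbf w_2\|)<\|\mathbf w_1-\mathbf w_2\|\big\},$$ $B(\mathbf w,r)$ is the ball in $\mathbb R^m$ with centre $\mathbf w$ and radius $r$, $\|\cdot\|$ is the Euclidean norm and $\lambda$ is the Lebesgue measure on $\mathbb R^m$. -/

import Mathlib

open MeasureTheory ProbabilityTheory Filter Topology Manifold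
open scoped ContDiff

/-- `w = (w₁, w₂)` lies in `Γ_{m;2}` when `max (‖w₁‖, ‖w₂‖) < ‖w₁ - w₂‖`. -/
def tripleRegion (m : ℕ) : Set (EuclideanSpace ℝ (Fin m) × EuclideanSpace ℝ (Fin m)) :=
  {w | max ‖w.1‖ ‖w.2‖ < ‖w.1 - w.2‖}

/-- `exp (-λ (B(w₁, ‖w₁‖) ∪ B(w₂, ‖w₂‖)))`, where `λ` is the Lebesgue measure on `ℝ^m`. -/
noncomputable def tripleIntegrand (m : ℕ)
    (w : EuclideanSpace ℝ (Fin m) × EuclideanSpace ℝ (Fin m)) : ℝ :=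
  Real.exp (-(volume (Metric.ball w.1 ‖w.1‖ ∪ Metric.ball w.2 ‖w.2‖)).toReal)

/-- The constant `𝔬_m`. -/
noncomputable def tripleConst (m : ℕ) : ℝ :=
  ∫ w in tripleRegion m, tripleIntegrand m w

/-- A law `μ` on an `m`-dimensional smooth manifold `M` is absolutely continuous in charts: for
every smooth chart `(U, ψ)` of `M`, the pushforward `ψ_* (μ|_U)` is absolutely continuous with
respect to the Lebesgue measure on `ψ(U)`. -/
def AbsContInCharts {m : ℕ} {M : Type*} [TopologicalSpace M]
    [ChartedSpace (EuclideanSpace ℝ (Fin m)) M] [MeasurableSpace M] (μ : Measure M) : Prop :=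
  ∀ ψ ∈ IsManifold.maximalAtlas (𝓡 m) ∞ M,
    Measure.map ψ (μ.restrict ψ.source) ≪ volume.restrict ψ.target

/-- `x j` is a nearest neighbour of `x i` among the other points of `x`. -/
def IsNearestNeighbor {E : Type*} [Dist E] {n : ℕ} (x : Fin n → E) (i j : Fin n) : Prop :=
  j ≠ i ∧ ∀ k, k ≠ i → dist (x i) (x j) ≤ dist (x i) (x k)

/-- In the directed graph with the edges `i → N i`, the number of ordered triples `(i, j, k)` of
distinct vertices with `i → k` and `j → k`. -/
def numTriples {n : ℕ} (N : Fin n → Fin n) : ℕ :=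
  (Finset.univ.filter fun t : Fin n × Fin n × Fin n =>
    t.1 ≠ t.2.1 ∧ t.1 ≠ t.2.2 ∧ t.2.1 ≠ t.2.2 ∧ N t.1 = t.2.2 ∧ N t.2.1 = t.2.2).card

/-!
# Triples in the directed nearest-neighbour graph

Fix the target `k` of the two edges and condition on `X k = x`. Given `X i = y` and `X j = z`, the
point `x` is the nearest neighbour of both if no other point lies in
`B(y, ‖y - x‖) ∪ B(z, ‖z - x‖)` and neither of `y` and `z` lies in the ball around the other, so
that the mean number of triples per vertex is an integral over `x` of
`(n - 1) (n - 2) ∬ 1{...} (1 - μ(B(y, ‖y - x‖) ∪ B(z, ‖z - x‖))) ^ (n - 3) μ(dy) μ(dz)`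
(`meanPairCount_eq`).

For almost every `x`, a chart and the Lebesgue differentiation theorem describe `μ` near `x` by a
density that is, at the scale `n ^ (-1 / m)`, close in `L¹` to a positive constant, and by a
parametrization that is close to a linear injection. This is recorded in the structure `LocalModel`,
and is all that is used of the manifold (`AbsContInCharts.ae_nonempty_localModel`). If `y` and `z`
are restricted to distance at most `R n ^ (-1 / m)` from `x`, the conditional mean then converges
(`LocalModel.tendsto_lintegral_pairWeight`), and a linear change of variables shows that the limit
is the integral that defines `𝔬_m`, up to a cut-off that disappears as `R → ∞`, whatever the density
and the tangent space at `x` are (`lintegral_pairLimit_eq`, `tendsto_lintegral_pairLimit`).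

Two interchanges of limits remain. A point is a nearest neighbour of a bounded number `K` of points
(`exists_hasKissingBound`), so the conditional means are at most `K ^ 2`, which allows dominated
convergence in `x` and shows that `𝔬_m` is finite. The same bound, applied to the edges that start
at vertices `i` whose nearest neighbour is at distance more than `R n ^ (-1 / m)`, shows that the
triples lost by the cut-off number at most `2 K` times such vertices (`numTriples_le`), and their
proportion tends to `0` as `n → ∞` and then `R → ∞`.

Ties can have positive probability: a piece of the submanifold may lie on a sphere around each point
of another piece. They are handled by a sandwich between the triples with a strict nearest neighbour
and those with a nearest neighbour in the weak sense, which have the same limit. Both are treated at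
once through a relation between `<` and `≤` (`IsComparison`).
-/

open Metric Module
open scoped ENNReal NNReal

set_option linter.unusedSectionVars false

/-! ### Integrals against densities that converge in `L¹` -/

section Density

variable {α : Type*} [MeasurableSpace α] {κ : Measure α} {f : ℕ → α → ℝ≥0} {p : ℝ≥0}

lemma NNReal.coe_le_coe_add_edist (a b : ℝ≥0) : (a : ℝ≥0∞) ≤ b + edist a b := by
  have h : a ≤ b + nndist a b := by
    rw [← NNReal.coe_le_coe]
    push_cast
    rw [NNReal.dist_eq]
    linarith [le_abs_self (a - b : ℝ)]
  rw [edist_nndist]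
  exact_mod_cast h

/-- If the densities `f n` converge to the constant `p` in `L¹(κ)` and the weights `G n`, bounded
by `1`, converge almost everywhere, then the weighted integrals converge. -/
lemma tendsto_lintegral_mul_of_tendsto_density [IsFiniteMeasure κ] {G : ℕ → α → ℝ≥0∞}
    {g : α → ℝ≥0∞} (hf : ∀ n, Measurable (f n)) (hG : ∀ n, Measurable (G n))
    (hG1 : ∀ n a, G n a ≤ 1)
    (hL : Tendsto (fun n => ∫⁻ a, edist (f n a) p ∂κ) atTop (𝓝 0))
    (hlim : ∀ᵐ a ∂κ, Tendsto (fun n => G n a) atTop (𝓝 (g a))) :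
    Tendsto (fun n => ∫⁻ a, G n a * f n a ∂κ) atTop (𝓝 (p * ∫⁻ a, g a ∂κ)) := by
  have hA : Tendsto (fun n => (p : ℝ≥0∞) * ∫⁻ a, G n a ∂κ) atTop (𝓝 (p * ∫⁻ a, g a ∂κ)) := by
    refine ENNReal.Tendsto.const_mul ?_ (Or.inr ENNReal.coe_ne_top)
    refine tendsto_lintegral_of_dominated_convergence (fun _ => 1) hG
      (fun n => ae_of_all _ (hG1 n)) ?_ hlim
    simp
  have hle : ∀ n a, G n a * f n a ≤ p * G n a + edist (f n a) p := by
    intro n a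
    have h1 : (f n a : ℝ≥0∞) ≤ p + edist (f n a) p := NNReal.coe_le_coe_add_edist _ _
    calc G n a * f n a ≤ G n a * (p + edist (f n a) p) := by gcongr
      _ = p * G n a + G n a * edist (f n a) p := by ring
      _ ≤ p * G n a + 1 * edist (f n a) p := by gcongr; exact hG1 n a
      _ = _ := by ring
  have hge : ∀ n a, p * G n a ≤ G n a * f n a + edist (f n a) p := by
    intro n a
    have h1 : (p : ℝ≥0∞) ≤ f n a + edist (f n a) p := by
      rw [edist_comm]
      exact NNReal.coe_le_coe_add_edist _ _
    calc p * G n a ≤ (f n a + edist (f n a) p) * G n a := by gcongr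
      _ = G n a * f n a + G n a * edist (f n a) p := by ring
      _ ≤ G n a * f n a + 1 * edist (f n a) p := by gcongr; exact hG1 n a
      _ = _ := by ring
  refine tendsto_of_tendsto_of_tendsto_of_le_of_le
    (g := fun n => p * ∫⁻ a, G n a ∂κ - ∫⁻ a, edist (f n a) p ∂κ)
    (h := fun n => p * ∫⁻ a, G n a ∂κ + ∫⁻ a, edist (f n a) p ∂κ) ?_ ?_ ?_ ?_
  · simpa using ENNReal.Tendsto.sub hA hL (Or.inr ENNReal.zero_ne_top)
  · simpa using hA.add hL
  · intro n
    rw [tsub_le_iff_right, ← lintegral_const_mul _ (hG n),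
      ← lintegral_add_right _ ((hf n).edist measurable_const)]
    exact lintegral_mono (hge n)
  · intro n
    simp only
    rw [← lintegral_const_mul _ (hG n), ← lintegral_add_right _ ((hf n).edist measurable_const)]
    exact lintegral_mono (hle n)

lemma edist_mul_mul_self_le (a b p : ℝ≥0) :
    edist (a * b) (p * p) ≤ edist a p * (p + edist b p) + p * edist b p := by
  have h : nndist (a * b) (p * p) ≤ nndist a p * (p + nndist b p) + p * nndist b p := by
    rw [← NNReal.coe_le_coe]
    push_cast
    simp only [NNReal.dist_eq, NNReal.coe_mul]
    have h1 : (a * b - p * p : ℝ) = (a - p) * b + p * (b - p) := by ring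
    have h2 : |(b : ℝ)| ≤ p + |(b - p : ℝ)| := by
      have := abs_add_le (p : ℝ) (b - p)
      simpa [abs_of_nonneg p.coe_nonneg] using this
    rw [h1]
    refine (abs_add_le _ _).trans ?_
    rw [abs_mul, abs_mul, abs_of_nonneg p.coe_nonneg]
    gcongr
  simp only [edist_nndist]
  exact_mod_cast h

/-- `L¹` convergence of densities passes to the product of two copies. -/
lemma tendsto_lintegral_edist_mul [IsFiniteMeasure κ] (hf : ∀ n, Measurable (f n))
    (hL : Tendsto (fun n => ∫⁻ a, edist (f n a) p ∂κ) atTop (𝓝 0)) :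
    Tendsto (fun n => ∫⁻ z, edist (f n z.1 * f n z.2) (p * p) ∂(κ.prod κ)) atTop (𝓝 0) := by
  have hm : ∀ n, Measurable fun a => edist (f n a) p := fun n => (hf n).edist measurable_const
  have hbd : ∀ n, ∫⁻ z, edist (f n z.1 * f n z.2) (p * p) ∂(κ.prod κ) ≤
      (∫⁻ a, edist (f n a) p ∂κ) * (p * κ Set.univ + ∫⁻ a, edist (f n a) p ∂κ) +
        p * (κ Set.univ * ∫⁻ a, edist (f n a) p ∂κ) := by
    intro n
    calc _ ≤ ∫⁻ z, (edist (f n z.1) p * (p + edist (f n z.2) p) + p * (1 * edist (f n z.2) p))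
          ∂(κ.prod κ) :=
        lintegral_mono fun z => by rw [one_mul]; exact edist_mul_mul_self_le _ _ _
      _ = _ := by
        rw [lintegral_add_left, lintegral_const_mul,
          lintegral_prod_mul (f := fun a => edist (f n a) p) (g := fun a => p + edist (f n a) p),
          lintegral_prod_mul (f := fun _ => 1) (g := fun a => edist (f n a) p),
          lintegral_add_left]
        · simp
        · fun_prop
        · fun_prop
        · exact (hm n).aemeasurable
        · exact (hm n).aemeasurable
        · exact ((hm n).const_add _).aemeasurable
        · exact ((hm n).comp measurable_snd).const_mul _
        · exact ((hm n).comp measurable_fst).mul (((hm n).comp measurable_snd).const_add _)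
  refine tendsto_of_tendsto_of_tendsto_of_le_of_le tendsto_const_nhds ?_ (fun _ => zero_le) hbd
  have hfin : (p : ℝ≥0∞) * κ Set.univ ≠ ⊤ :=
    ENNReal.mul_ne_top ENNReal.coe_ne_top (measure_ne_top _ _)
  have h1 := ENNReal.Tendsto.mul hL (Or.inr (by simpa using hfin)) (tendsto_const_nhds.add hL)
    (Or.inr ENNReal.zero_ne_top) (b := p * κ Set.univ + 0)
  have h2 := ENNReal.Tendsto.const_mul (a := p) (ENNReal.Tendsto.const_mul (a := κ Set.univ) hL
    (Or.inr (measure_ne_top _ _))) (Or.inr ENNReal.coe_ne_top)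
  simpa using h1.add h2

end Density

/-! ### The law near a typical point -/

section LocalModel

/-- A description of the measure `μ` on the metric space `S` in a neighbourhood of the point `x`:
there, `μ` is the image under `param` of a measure on `F` with density `dens`, `param` is
metrically differentiable at the preimage `center` of `x`, with the metric differential
`‖lin u - lin w‖`, and `dens` has the positive Lebesgue value `val` at `center`. No continuity of
`param` is asked for; points where `dens` vanishes play no role, and the others are controlled by
`norm_le`. -/
structure LocalModel (F : Type*) [NormedAddCommGroup F] [NormedSpace ℝ F] [MeasureSpace F]
    {S : Type*} [MetricSpace S] [MeasurableSpace S] (μ : Measure S) (x : S) where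
  /-- The local parametrization. -/
  param : F → S
  /-- The density of the law in the parameter space. -/
  dens : F → ℝ≥0
  /-- The parameter of the base point. -/
  center : F
  /-- A linear map that induces the metric differential of `param` at `center`. -/
  lin : F ≃L[ℝ] F
  /-- The Lebesgue value of the density at `center`. -/
  val : ℝ≥0
  /-- A Lipschitz constant at the base point for the inverse of `param`. -/
  bound : ℝ
  /-- The radius of the neighbourhood that is described. -/
  radius : ℝ
  measurable_param : Measurable param
  measurable_dens : Measurable dens
  val_pos : 0 < val
  bound_pos : 0 < bound
  radius_pos : 0 < radius
  param_center : param center = x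
  restrict_eq : μ.restrict (closedBall x radius) =
    Measure.map param (volume.withDensity fun u => (dens u : ℝ≥0∞))
  norm_le : ∀ u, dens u ≠ 0 → ‖u - center‖ ≤ bound * dist (param u) x
  tendsto_dist : ∀ u w, Tendsto
    (fun ε : ℝ => dist (param (center + ε • u)) (param (center + ε • w)) / ε) (𝓝[>] 0)
    (𝓝 ‖lin u - lin w‖)
  tendsto_dens : ∀ ρ : ℝ, Tendsto
    (fun ε : ℝ => ∫⁻ u in closedBall 0 ρ, edist (dens (center + ε • u)) val) (𝓝[>] 0) (𝓝 0)

/-- The length scale `(N + 3) ^ (-1 / D)` of the nearest neighbour distances between `N + 3` points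
in dimension `D`. Sample sizes are written `N + 3` throughout: `N` points remain when a triple is
removed. -/
noncomputable def nnScale (D N : ℕ) : ℝ := ((N : ℝ) + 3) ^ (-(1 / (D : ℝ)))

lemma nnScale_pos (D N : ℕ) : 0 < nnScale D N := by unfold nnScale; positivity

lemma nnScale_pow {D : ℕ} (hD : D ≠ 0) (N : ℕ) : nnScale D N ^ D = ((N : ℝ) + 3)⁻¹ := by
  unfold nnScale
  rw [← Real.rpow_natCast, ← Real.rpow_mul (by positivity)]
  have : (D : ℝ) ≠ 0 := by exact_mod_cast hD
  rw [show -(1 / (D : ℝ)) * D = -1 by field_simp, Real.rpow_neg_one]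

lemma tendsto_nnScale {D : ℕ} (hD : D ≠ 0) : Tendsto (nnScale D) atTop (𝓝[>] 0) := by
  refine tendsto_nhdsWithin_iff.2 ⟨?_, Eventually.of_forall fun N => nnScale_pos D N⟩
  have hD' : (0 : ℝ) < D := by exact_mod_cast Nat.pos_of_ne_zero hD
  exact (tendsto_rpow_neg_atTop (y := 1 / (D : ℝ)) (by positivity)).comp
    (tendsto_atTop_add_const_right _ _ tendsto_natCast_atTop_atTop)

lemma natCast_add_three_mul_ofReal_nnScale_pow {D : ℕ} (hD : D ≠ 0) (N : ℕ) :
    ((N : ℝ≥0∞) + 3) * ENNReal.ofReal (nnScale D N ^ D) = 1 := by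
  rw [nnScale_pow hD, ENNReal.ofReal_inv_of_pos (by positivity),
    ENNReal.ofReal_add (by positivity) (by norm_num), ENNReal.ofReal_natCast]
  norm_num
  exact ENNReal.mul_inv_cancel (by simp) (by simp)

variable {F : Type*} [NormedAddCommGroup F] [NormedSpace ℝ F] [FiniteDimensional ℝ F]
  [MeasureSpace F] [BorelSpace F] [(volume : Measure F).IsAddHaarMeasure]

lemma lintegral_eq_ofReal_pow_mul_lintegral_add_smul (a : F) {ε : ℝ} (hε : 0 < ε)
    {k : F → ℝ≥0∞} (hk : Measurable k) :
    ∫⁻ u, k u = ENNReal.ofReal (ε ^ finrank ℝ F) * ∫⁻ u, k (a + ε • u) := by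
  have h := Measure.map_addHaar_smul (volume : Measure F) hε.ne'
  have h2 : ∫⁻ u, k (a + ε • u) = ∫⁻ u, k (a + u) ∂(Measure.map (fun x : F => ε • x) volume) := by
    rw [lintegral_map (by fun_prop) (by fun_prop)]
  rw [h2, h, lintegral_smul_measure, lintegral_add_left_eq_self, smul_eq_mul, ← mul_assoc,
    ← ENNReal.ofReal_mul (by positivity), abs_of_pos (by positivity), mul_inv_cancel₀
      (by positivity)]
  simp

namespace LocalModel

variable {S : Type*} [MetricSpace S] [MeasurableSpace S] {μ : Measure S} {x : S}

section
variable (M : LocalModel F μ x)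

/-- The parametrization, seen at the scale of the nearest neighbour distances. -/
noncomputable def zoom (N : ℕ) (u : F) : S :=
  M.param (M.center + nnScale (finrank ℝ F) N • u)

/-- The density, seen at the scale of the nearest neighbour distances. -/
noncomputable def zoomDens (N : ℕ) (u : F) : ℝ≥0 :=
  M.dens (M.center + nnScale (finrank ℝ F) N • u)

@[fun_prop]
lemma measurable_zoom (N : ℕ) : Measurable (M.zoom N) := by
  have := M.measurable_param
  unfold zoom; fun_prop

@[fun_prop]
lemma measurable_zoomDens (N : ℕ) : Measurable (M.zoomDens N) := by
  have := M.measurable_dens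
  unfold zoomDens; fun_prop

lemma norm_le_of_zoomDens_ne_zero {N : ℕ} {u : F} {K : ℝ} (h : M.zoomDens N u ≠ 0)
    (hK : dist (M.zoom N u) x ≤ K * nnScale (finrank ℝ F) N) : ‖u‖ ≤ M.bound * K := by
  have h1 := M.norm_le _ h
  have hε := nnScale_pos (finrank ℝ F) N
  rw [add_sub_cancel_left, norm_smul, Real.norm_of_nonneg hε.le] at h1
  have h2 := h1.trans (mul_le_mul_of_nonneg_left hK M.bound_pos.le)
  refine le_of_mul_le_mul_left ?_ hε
  linarith

/-- Integrals of functions supported near `x`, in the rescaled parametrization. -/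
lemma natCast_mul_lintegral [Nontrivial F] {N : ℕ} {h : S → ℝ≥0∞} (hh : Measurable h)
    (hsupp : ∀ y, h y ≠ 0 → y ∈ closedBall x M.radius) :
    ((N : ℝ≥0∞) + 3) * ∫⁻ y, h y ∂μ = ∫⁻ u, h (M.zoom N u) * M.zoomDens N u := by
  have hp := M.measurable_param
  have hd := M.measurable_dens
  have h1 : ∫⁻ y, h y ∂μ = ∫⁻ y in closedBall x M.radius, h y ∂μ :=
    (setLIntegral_eq_of_support_subset fun y hy => hsupp y hy).symm
  rw [h1, M.restrict_eq, lintegral_map hh hp,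
    lintegral_withDensity_eq_lintegral_mul _ (by fun_prop) (by fun_prop),
    lintegral_eq_ofReal_pow_mul_lintegral_add_smul M.center (nnScale_pos (finrank ℝ F) N)
      (by fun_prop), ← mul_assoc,
    natCast_add_three_mul_ofReal_nnScale_pow finrank_pos.ne', one_mul]
  simp only [Pi.mul_apply, mul_comm (h _)]
  rfl

lemma tendsto_lintegral_edist_zoomDens [Nontrivial F] (ρ : ℝ) :
    Tendsto (fun N => ∫⁻ u in closedBall 0 ρ, edist (M.zoomDens N u) M.val) atTop (𝓝 0) :=
  (M.tendsto_dens ρ).comp (tendsto_nnScale finrank_pos.ne')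

lemma tendsto_dist_zoom [Nontrivial F] (u w : F) :
    Tendsto (fun N => dist (M.zoom N u) (M.zoom N w) / nnScale (finrank ℝ F) N) atTop
      (𝓝 ‖M.lin u - M.lin w‖) :=
  (M.tendsto_dist u w).comp (tendsto_nnScale finrank_pos.ne')

lemma zoom_zero (N : ℕ) : M.zoom N 0 = x := by simp [zoom, M.param_center]

lemma tendsto_dist_zoom_base [Nontrivial F] (u : F) :
    Tendsto (fun N => dist (M.zoom N u) x / nnScale (finrank ℝ F) N) atTop (𝓝 ‖M.lin u‖) := by
  simpa [zoom_zero] using M.tendsto_dist_zoom u 0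

lemma eventually_mul_nnScale_le [Nontrivial F] (K : ℝ) :
    ∀ᶠ N in atTop, K * nnScale (finrank ℝ F) N ≤ M.radius := by
  have h := (tendsto_nhdsWithin_iff.1
    (tendsto_nnScale (finrank_pos (R := ℝ) (M := F)).ne')).1.const_mul K
  rw [mul_zero] at h
  exact h.eventually_le_const M.radius_pos

/-- The rescaled measures of small sets converge if the sets converge in the parameter space. -/
lemma tendsto_measure [Nontrivial F] {A : ℕ → Set S} {B : Set F} {K : ℝ}
    (hA : ∀ N, MeasurableSet (A N)) (hB : MeasurableSet B) (hBb : Bornology.IsBounded B)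
    (hAs : ∀ᶠ N in atTop, A N ⊆ closedBall x (K * nnScale (finrank ℝ F) N))
    (hlim : ∀ᵐ w : F, ∀ᶠ N in atTop, (M.zoom N w ∈ A N ↔ w ∈ B)) :
    Tendsto (fun N : ℕ => ((N : ℝ≥0∞) + 3) * μ (A N)) atTop (𝓝 (M.val * volume B)) := by
  obtain ⟨ρ₀, hρ₀⟩ := hBb.subset_closedBall 0
  set ρ := max ρ₀ (M.bound * K)
  have hBρ : B ⊆ closedBall 0 ρ := hρ₀.trans (closedBall_subset_closedBall (le_max_left _ _))
  have hBeq : ∫⁻ w in closedBall (0 : F) ρ, B.indicator 1 w = volume B := by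
    rw [lintegral_indicator_one hB, Measure.restrict_apply hB, Set.inter_eq_left.2 hBρ]
  have : IsFiniteMeasure (volume.restrict (closedBall (0 : F) ρ)) :=
    ⟨by simpa using measure_closedBall_lt_top⟩
  have key := tendsto_lintegral_mul_of_tendsto_density
    (κ := volume.restrict (closedBall (0 : F) ρ)) (f := M.zoomDens) (p := M.val)
    (G := fun N w => (A N).indicator 1 (M.zoom N w)) (g := B.indicator 1)
    (fun N => M.measurable_zoomDens N)
    (fun N => (measurable_one.indicator (hA N)).comp (M.measurable_zoom N))
    (fun N w => Set.indicator_le_self' (fun _ _ => zero_le) _)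
    (M.tendsto_lintegral_edist_zoomDens ρ) (ae_restrict_of_ae ?_)
  · rw [hBeq] at key
    refine key.congr' ?_
    filter_upwards [hAs, M.eventually_mul_nnScale_le K] with N h1 h2
    rw [← lintegral_indicator_one (hA N), M.natCast_mul_lintegral
      (measurable_one.indicator (hA N))]
    · refine setLIntegral_eq_of_support_subset fun w hw => ?_
      have hw1 : M.zoom N w ∈ A N := by
        by_contra h; simp [h] at hw
      have hw2 : M.zoomDens N w ≠ 0 := by
        intro h; simp [h] at hw
      rw [mem_closedBall_zero_iff]
      exact (M.norm_le_of_zoomDens_ne_zero hw2 (h1 hw1)).trans (le_max_right _ _)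
    · intro y hy
      have : y ∈ A N := by by_contra h; simp [h] at hy
      exact closedBall_subset_closedBall h2 (h1 this)
  · filter_upwards [hlim] with w hw
    refine tendsto_const_nhds.congr' ?_
    filter_upwards [hw] with N hN
    by_cases h : w ∈ B
    · simp [h, hN.2 h]
    · simp [h, mt hN.1 h]

/-- The two-variable analogue of `LocalModel.tendsto_measure`, for functions. -/
lemma tendsto_lintegral_lintegral [Nontrivial F] [IsFiniteMeasure μ]
    {g : ℕ → S × S → ℝ≥0∞} {G : F × F → ℝ≥0∞} {K ρ₀ : ℝ}
    (hg : ∀ N, Measurable (g N)) (hg1 : ∀ N q, g N q ≤ 1)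
    (hgs : ∀ N q, g N q ≠ 0 → dist q.1 x ≤ K * nnScale (finrank ℝ F) N ∧
      dist q.2 x ≤ K * nnScale (finrank ℝ F) N)
    (hGs : ∀ q, G q ≠ 0 → ‖q.1‖ ≤ ρ₀ ∧ ‖q.2‖ ≤ ρ₀)
    (hlim : ∀ᵐ q : F × F, Tendsto (fun N => g N (M.zoom N q.1, M.zoom N q.2)) atTop (𝓝 (G q))) :
    Tendsto (fun N : ℕ => ((N : ℝ≥0∞) + 3) ^ 2 * ∫⁻ y, ∫⁻ z, g N (y, z) ∂μ ∂μ) atTop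
      (𝓝 ((M.val * M.val : ℝ≥0) * ∫⁻ q, G q)) := by
  set ρ := max ρ₀ (M.bound * K)
  set κ := volume.restrict (closedBall (0 : F) ρ) with hκ
  have : IsFiniteMeasure κ := ⟨by simpa [hκ] using measure_closedBall_lt_top⟩
  have hκ2 : κ.prod κ = volume.restrict (closedBall (0 : F) ρ ×ˢ closedBall (0 : F) ρ) :=
    Measure.prod_restrict _ _
  have hGeq : ∫⁻ q, G q ∂(κ.prod κ) = ∫⁻ q, G q := by
    rw [hκ2]
    refine setLIntegral_eq_of_support_subset fun q hq => ?_
    obtain ⟨h1, h2⟩ := hGs q hq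
    exact ⟨mem_closedBall_zero_iff.2 (h1.trans (le_max_left _ _)),
      mem_closedBall_zero_iff.2 (h2.trans (le_max_left _ _))⟩
  have key := tendsto_lintegral_mul_of_tendsto_density (κ := κ.prod κ)
    (f := fun N q => M.zoomDens N q.1 * M.zoomDens N q.2) (p := M.val * M.val)
    (G := fun N q => g N (M.zoom N q.1, M.zoom N q.2)) (g := G)
    (fun N => by fun_prop) (fun N => (hg N).comp (by fun_prop)) (fun N q => hg1 _ _)
    (tendsto_lintegral_edist_mul (fun N => M.measurable_zoomDens N)
      (M.tendsto_lintegral_edist_zoomDens ρ))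
    (by rw [hκ2]; exact ae_restrict_of_ae hlim)
  rw [hGeq] at key
  refine key.congr' ?_
  filter_upwards [M.eventually_mul_nnScale_le K] with N h2
  have hin : ∀ y, ((N : ℝ≥0∞) + 3) * ∫⁻ z, g N (y, z) ∂μ =
      ∫⁻ v, g N (y, M.zoom N v) * M.zoomDens N v := fun y =>
    M.natCast_mul_lintegral ((hg N).comp (by fun_prop)) fun z hz =>
      (hgs N _ hz).2.trans h2
  have hm : Measurable fun y => ∫⁻ v, g N (y, M.zoom N v) * M.zoomDens N v := by
    have : Measurable fun q : S × F => g N (q.1, M.zoom N q.2) * M.zoomDens N q.2 :=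
      ((hg N).comp (by fun_prop)).mul (by fun_prop)
    exact this.lintegral_prod_right'
  rw [hκ2, pow_two, mul_assoc, ← lintegral_const_mul _ (hg N).lintegral_prod_right']
  simp only [hin]
  rw [M.natCast_mul_lintegral hm]
  · rw [setLIntegral_eq_of_support_subset]
    · rw [Measure.volume_eq_prod, lintegral_prod]
      · refine lintegral_congr fun u => ?_
        rw [← lintegral_mul_const' _ _ ENNReal.coe_ne_top]
        refine lintegral_congr fun v => ?_
        push_cast
        ring
      · exact (((hg N).comp (by fun_prop)).mul (by fun_prop)).aemeasurable
    · intro q hq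
      have h1 : g N (M.zoom N q.1, M.zoom N q.2) ≠ 0 := by
        intro h; simp [h] at hq
      have h3 : M.zoomDens N q.1 ≠ 0 := by intro h; simp [h] at hq
      have h4 : M.zoomDens N q.2 ≠ 0 := by intro h; simp [h] at hq
      obtain ⟨h5, h6⟩ := hgs N _ h1
      exact ⟨mem_closedBall_zero_iff.2
          ((M.norm_le_of_zoomDens_ne_zero h3 h5).trans (le_max_right _ _)),
        mem_closedBall_zero_iff.2
          ((M.norm_le_of_zoomDens_ne_zero h4 h6).trans (le_max_right _ _))⟩
  · intro y hy
    by_contra hy2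
    refine hy ?_
    have : ∀ v, g N (y, M.zoom N v) = 0 := by
      intro v
      by_contra h
      exact hy2 ((hgs N _ h).1.trans h2)
    simp [this]

end

end LocalModel

end LocalModel

/-! ### Pairs of points with a common nearest neighbour -/

/-- A relation between `<` and `≤`. The relation `<` gives lower bounds for the number of triples,
which ties do not disturb, and the relation `≤` gives upper bounds. -/
structure IsComparison (rel : ℝ → ℝ → Prop) : Prop where
  of_lt : ∀ {a b}, a < b → rel a b
  le : ∀ {a b}, rel a b → a ≤ b
  measurableSet : MeasurableSet {q : ℝ × ℝ | rel q.1 q.2}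

lemma isComparison_lt : IsComparison (fun a b => a < b) :=
  ⟨id, le_of_lt, measurableSet_lt measurable_fst measurable_snd⟩

lemma isComparison_le : IsComparison (fun a b => a ≤ b) :=
  ⟨le_of_lt, id, measurableSet_le measurable_fst measurable_snd⟩

section PairWeight

variable {S : Type*} [MetricSpace S]

/-- The possible positions of a further point for which `x` remains a nearest neighbour of `y` and
of `z`. -/
def freeSet (rel : ℝ → ℝ → Prop) (x y z : S) : Set S :=
  {w | rel (dist y x) (dist y w) ∧ rel (dist z x) (dist z w)}

/-- Among `x`, `y` and `z`, the point `x` is a nearest neighbour of `y` and of `z`, at distance at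
most `r`. -/
def PairCond (rel : ℝ → ℝ → Prop) (r : ℝ) (x y z : S) : Prop :=
  dist y x ≤ r ∧ dist z x ≤ r ∧ rel (dist y x) (dist y z) ∧ rel (dist z x) (dist z y)

open scoped Classical in
/-- The probability that `x` is a nearest neighbour of `y` and of `z`, at distance at most `r`, in
the presence of `N` further points with law `μ`. -/
noncomputable def pairWeight [MeasurableSpace S] (μ : Measure S) (rel : ℝ → ℝ → Prop) (r : ℝ)
    (N : ℕ) (x y z : S) : ℝ≥0∞ :=
  if PairCond rel r x y z then μ (freeSet rel x y z) ^ N else 0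

variable [MeasurableSpace S] [BorelSpace S] [SecondCountableTopology S] {rel : ℝ → ℝ → Prop}

lemma IsComparison.measurableSet_setOf (hrel : IsComparison rel) {β : Type*} [MeasurableSpace β]
    {f g : β → ℝ} (hf : Measurable f) (hg : Measurable g) : MeasurableSet {b | rel (f b) (g b)} :=
  hrel.measurableSet.preimage (hf.prodMk hg)

lemma measurableSet_freeSet_prod (hrel : IsComparison rel) :
    MeasurableSet {q : (S × S × S) × S | q.2 ∈ freeSet rel q.1.1 q.1.2.1 q.1.2.2} :=
  (hrel.measurableSet_setOf (by fun_prop) (by fun_prop)).inter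
    (hrel.measurableSet_setOf (by fun_prop) (by fun_prop))

lemma measurableSet_freeSet (hrel : IsComparison rel) (x y z : S) :
    MeasurableSet (freeSet rel x y z) :=
  (measurableSet_freeSet_prod hrel).preimage (measurable_const.prodMk measurable_id :
    Measurable fun w : S => ((x, y, z), w))

lemma measurableSet_pairCond (hrel : IsComparison rel) (r : ℝ) :
    MeasurableSet {q : S × S × S | PairCond rel r q.1 q.2.1 q.2.2} := by
  have h1 : MeasurableSet {q : S × S × S | dist q.2.1 q.1 ≤ r} :=
    measurableSet_le (by fun_prop) (by fun_prop)
  have h2 : MeasurableSet {q : S × S × S | dist q.2.2 q.1 ≤ r} :=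
    measurableSet_le (by fun_prop) (by fun_prop)
  have h3 : MeasurableSet {q : S × S × S | rel (dist q.2.1 q.1) (dist q.2.1 q.2.2)} :=
    hrel.measurableSet_setOf (by fun_prop) (by fun_prop)
  have h4 : MeasurableSet {q : S × S × S | rel (dist q.2.2 q.1) (dist q.2.2 q.2.1)} :=
    hrel.measurableSet_setOf (by fun_prop) (by fun_prop)
  exact h1.inter (h2.inter (h3.inter h4))

lemma measurable_pairWeight {μ : Measure S} [IsFiniteMeasure μ] (hrel : IsComparison rel) (r : ℝ)
    (N : ℕ) : Measurable fun q : S × S × S => pairWeight μ rel r N q.1 q.2.1 q.2.2 := by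
  unfold pairWeight
  exact Measurable.ite (measurableSet_pairCond hrel r)
    ((measurable_measure_prodMk_left (measurableSet_freeSet_prod hrel)).pow_const N)
    measurable_const

lemma pairWeight_le_one {μ : Measure S} [IsProbabilityMeasure μ] (r : ℝ) (N : ℕ) (x y z : S) :
    pairWeight μ rel r N x y z ≤ 1 := by
  unfold pairWeight
  split_ifs
  · exact pow_le_one₀ zero_le prob_le_one
  · exact zero_le

end PairWeight

/-! ### The local limit -/

section Limit

lemma IsComparison.eventually_iff {rel : ℝ → ℝ → Prop} (hrel : IsComparison rel)
    {f g ε : ℕ → ℝ} {a b : ℝ} (hε : ∀ N, 0 < ε N)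
    (hf : Tendsto (fun N => f N / ε N) atTop (𝓝 a)) (hg : Tendsto (fun N => g N / ε N) atTop (𝓝 b))
    (hab : a ≠ b) : ∀ᶠ N in atTop, (rel (f N) (g N) ↔ a < b) := by
  rcases lt_or_gt_of_ne hab with h | h
  · filter_upwards [hf.eventually_lt hg h] with N hN
    exact iff_of_true (hrel.of_lt ((div_lt_div_iff_of_pos_right (hε N)).1 hN)) h
  · filter_upwards [hg.eventually_lt hf h] with N hN
    refine iff_of_false (fun h2 => ?_) h.not_gt
    exact (hrel.le h2).not_gt ((div_lt_div_iff_of_pos_right (hε N)).1 hN)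

/-- The law of small numbers for the probability that `N + k` points avoid a small set. -/
lemma tendsto_measure_compl_pow {S : Type*} [MeasurableSpace S] {μ : Measure S}
    [IsProbabilityMeasure μ] {A : ℕ → Set S} (hA : ∀ N, MeasurableSet (A N)) {t : ℝ≥0∞}
    (ht : t ≠ ⊤) (hlim : Tendsto (fun N : ℕ => ((N : ℝ≥0∞) + 3) * μ (A N)) atTop (𝓝 t)) (k : ℕ) :
    Tendsto (fun N => μ (A N)ᶜ ^ (N + k)) atTop (𝓝 (ENNReal.ofReal (Real.exp (-t.toReal)))) := by
  have h1 : Tendsto (fun N : ℕ => ((N : ℝ) + 3) * μ.real (A N)) atTop (𝓝 t.toReal) := by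
    refine ((ENNReal.tendsto_toReal ht).comp hlim).congr fun N => ?_
    simp only [Function.comp_apply, ENNReal.toReal_mul, Measure.real]
    rw [ENNReal.toReal_add (by simp) (by simp)]
    simp
  have h3 : Tendsto (fun N : ℕ => ((N : ℝ) + 3)⁻¹) atTop (𝓝 0) :=
    tendsto_inv_atTop_zero.comp
      (tendsto_atTop_add_const_right _ _ tendsto_natCast_atTop_atTop)
  have h2 : Tendsto (fun N : ℕ => μ.real (A N)) atTop (𝓝 0) := by
    have := h1.mul h3
    rw [mul_zero] at this
    refine this.congr fun N => ?_
    have : (N : ℝ) + 3 ≠ 0 := by positivity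
    field_simp
  have h4 : Tendsto (fun N : ℕ => (N : ℝ) * -μ.real (A N)) atTop (𝓝 (-t.toReal)) := by
    have := (h1.sub (h2.const_mul 3)).neg
    rw [mul_zero, sub_zero] at this
    refine this.congr fun N => by ring
  have h5 := (Real.tendsto_one_add_pow_exp_of_tendsto h4).mul
    ((h2.neg.const_add 1).pow k)
  have h6 := ENNReal.tendsto_ofReal h5
  simp only [neg_zero, add_zero, one_pow, mul_one] at h6
  refine h6.congr fun N => ?_
  rw [← pow_add, ← sub_eq_add_neg, ← probReal_compl_eq_one_sub (hA N),
    ENNReal.ofReal_pow measureReal_nonneg, ofReal_measureReal]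

variable {F : Type*} [NormedAddCommGroup F] [NormedSpace ℝ F] [FiniteDimensional ℝ F]
  [MeasureSpace F] [BorelSpace F] [(volume : Measure F).IsAddHaarMeasure]

/-- The union of two balls around `u` and `v`, with the origin on their boundaries, for the norm
`‖T ·‖`. -/
def ballUnion (T : F ≃L[ℝ] F) (u v : F) : Set F :=
  {w | ‖T u - T w‖ < ‖T u‖ ∨ ‖T v - T w‖ < ‖T v‖}

/-- The pairs of points in the ball of radius `R` that are closer to the origin than to each other,
for the norm `‖T ·‖`. -/
def pairRegion (T : F ≃L[ℝ] F) (R : ℝ) : Set (F × F) :=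
  {q | ‖T q.1‖ ≤ R ∧ ‖T q.2‖ ≤ R ∧ ‖T q.1‖ < ‖T q.1 - T q.2‖ ∧ ‖T q.2‖ < ‖T q.2 - T q.1‖}

/-- The limit of the rescaled weights of pairs. -/
noncomputable def pairLimit (T : F ≃L[ℝ] F) (p : ℝ≥0) (R : ℝ) : F × F → ℝ≥0∞ :=
  (pairRegion T R).indicator fun q =>
    ENNReal.ofReal (Real.exp (-((p : ℝ≥0∞) * volume (ballUnion T q.1 q.2)).toReal))

lemma measurableSet_ballUnion (T : F ≃L[ℝ] F) (u v : F) : MeasurableSet (ballUnion T u v) := by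
  have h1 : IsOpen {w | ‖T u - T w‖ < ‖T u‖} := isOpen_lt (by fun_prop) (by fun_prop)
  have h2 : IsOpen {w | ‖T v - T w‖ < ‖T v‖} := isOpen_lt (by fun_prop) (by fun_prop)
  exact (h1.union h2).measurableSet

lemma isBounded_norm_le (T : F ≃L[ℝ] F) (R : ℝ) : Bornology.IsBounded {w | ‖T w‖ ≤ R} := by
  have := T.antilipschitz.isBounded_preimage (isBounded_closedBall (x := (0 : F)) (r := R))
  refine this.subset fun w hw => ?_
  simpa using hw

lemma isBounded_ballUnion (T : F ≃L[ℝ] F) (u v : F) : Bornology.IsBounded (ballUnion T u v) := by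
  refine (isBounded_norm_le T (2 * max ‖T u‖ ‖T v‖)).subset fun w hw => ?_
  have h1 := le_max_left ‖T u‖ ‖T v‖
  have h2 := le_max_right ‖T u‖ ‖T v‖
  have h3 := norm_sub_norm_le (T w) (T u)
  have h4 := norm_sub_norm_le (T w) (T v)
  rw [norm_sub_rev] at h3 h4
  rcases hw with hw | hw
  · change ‖T w‖ ≤ _; linarith
  · change ‖T w‖ ≤ _; linarith

lemma ae_norm_sub_ne [Nontrivial F] (T : F ≃L[ℝ] F) (b : F) (c : ℝ) :
    ∀ᵐ w : F, ‖b - T w‖ ≠ c := by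
  rw [ae_iff]
  have : {w | ¬‖b - T w‖ ≠ c} = T.toLinearEquiv ⁻¹' sphere b c := by
    ext w; simp [norm_sub_rev]
  rw [this, Measure.addHaar_preimage_linearEquiv, Measure.addHaar_sphere, mul_zero]

lemma ae_norm_ne [Nontrivial F] (T : F ≃L[ℝ] F) (c : ℝ) : ∀ᵐ w : F, ‖T w‖ ≠ c := by
  simpa using ae_norm_sub_ne T 0 c

namespace LocalModel

variable {S : Type*} [MetricSpace S] [MeasurableSpace S] {μ : Measure S} {x : S}
  [BorelSpace S] [SecondCountableTopology S] [IsProbabilityMeasure μ] (M : LocalModel F μ x)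
  {rel : ℝ → ℝ → Prop}

/-- The probability that `N + 2` points are far from `x` at the scale of the nearest neighbour
distances. -/
lemma tendsto_measure_compl_closedBall_pow [Nontrivial F] (R : ℝ) :
    Tendsto (fun N => μ (closedBall x (R * nnScale (finrank ℝ F) N))ᶜ ^ (N + 2)) atTop
      (𝓝 (ENNReal.ofReal (Real.exp (-((M.val : ℝ≥0∞) * volume {w | ‖M.lin w‖ ≤ R}).toReal)))) := by
  have hfin := (isBounded_norm_le M.lin R).measure_lt_top (μ := (volume : Measure F))
  refine tendsto_measure_compl_pow (fun N => measurableSet_closedBall)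
    (ENNReal.mul_ne_top ENNReal.coe_ne_top hfin.ne) ?_ 2
  refine M.tendsto_measure (K := R) (fun N => measurableSet_closedBall)
    (isClosed_le (by fun_prop) (by fun_prop)).measurableSet (isBounded_norm_le M.lin R)
    (Eventually.of_forall fun N => subset_rfl) ?_
  filter_upwards [ae_norm_ne M.lin R] with w hw
  have hR : Tendsto (fun N => R * nnScale (finrank ℝ F) N / nnScale (finrank ℝ F) N) atTop
      (𝓝 R) :=
    tendsto_const_nhds.congr fun N => (mul_div_cancel_right₀ _ (nnScale_pos _ N).ne').symm
  filter_upwards [isComparison_le.eventually_iff (nnScale_pos _) (M.tendsto_dist_zoom_base w) hR hw]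
    with N hN
  rw [mem_closedBall, hN]
  exact ⟨le_of_lt, fun h => lt_of_le_of_ne h hw⟩

/-- A point that prevents `x` from being a nearest neighbour of `y` and of `z` is close to `x`. -/
lemma compl_freeSet_subset (hrel : IsComparison rel) (x y z : S) :
    (freeSet rel x y z)ᶜ ⊆ closedBall x (2 * max (dist y x) (dist z x)) := by
  intro w hw
  have h1 := le_max_left (dist y x) (dist z x)
  have h2 := le_max_right (dist y x) (dist z x)
  have h3 := dist_triangle_left w x y
  have h4 := dist_triangle_left w x z
  rw [mem_closedBall]
  rw [freeSet, Set.mem_compl_iff, Set.mem_ofPred_eq, not_and_or] at hw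
  rcases hw with hw | hw
  · have := not_lt.1 (mt hrel.of_lt hw); linarith
  · have := not_lt.1 (mt hrel.of_lt hw); linarith

lemma tendsto_measure_freeSet_pow [Nontrivial F] (hrel : IsComparison rel) (u v : F) :
    Tendsto (fun N => μ (freeSet rel x (M.zoom N u) (M.zoom N v)) ^ N) atTop
      (𝓝 (ENNReal.ofReal
        (Real.exp (-((M.val : ℝ≥0∞) * volume (ballUnion M.lin u v)).toReal)))) := by
  have hfin := (isBounded_ballUnion M.lin u v).measure_lt_top (μ := (volume : Measure F))
  have hm : ∀ N, MeasurableSet (freeSet rel x (M.zoom N u) (M.zoom N v))ᶜ := fun N =>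
    (measurableSet_freeSet hrel _ _ _).compl
  have key := tendsto_measure_compl_pow (μ := μ) hm
    (ENNReal.mul_ne_top ENNReal.coe_ne_top hfin.ne) (t := M.val * volume (ballUnion M.lin u v))
    ?_ 0
  · simpa using key
  refine M.tendsto_measure (K := 2 * (max ‖M.lin u‖ ‖M.lin v‖ + 1)) hm
    (measurableSet_ballUnion _ _ _) (isBounded_ballUnion _ _ _) ?_ ?_
  · have hε := nnScale_pos (finrank ℝ F)
    filter_upwards [(M.tendsto_dist_zoom_base u).eventually_lt_const (lt_add_one _),
      (M.tendsto_dist_zoom_base v).eventually_lt_const (lt_add_one _)] with N h1 h2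
    rw [div_lt_iff₀ (hε N)] at h1 h2
    refine (compl_freeSet_subset hrel _ _ _).trans (closedBall_subset_closedBall ?_)
    rw [mul_assoc]
    refine mul_le_mul_of_nonneg_left (max_le ?_ ?_) zero_le_two
    · refine h1.le.trans (mul_le_mul_of_nonneg_right ?_ (hε N).le)
      gcongr; exact le_max_left _ _
    · refine h2.le.trans (mul_le_mul_of_nonneg_right ?_ (hε N).le)
      gcongr; exact le_max_right _ _
  · filter_upwards [ae_norm_sub_ne M.lin (M.lin u) ‖M.lin u‖,
      ae_norm_sub_ne M.lin (M.lin v) ‖M.lin v‖] with w h1 h2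
    filter_upwards [hrel.eventually_iff (nnScale_pos _) (M.tendsto_dist_zoom_base u)
      (M.tendsto_dist_zoom u w) h1.symm, hrel.eventually_iff (nnScale_pos _)
      (M.tendsto_dist_zoom_base v) (M.tendsto_dist_zoom v w) h2.symm] with N h3 h4
    rw [freeSet, Set.mem_compl_iff, Set.mem_ofPred_eq, h3, h4, ballUnion, Set.mem_ofPred_eq,
      not_and_or, not_lt, not_lt, h1.le_iff_lt, h2.le_iff_lt]

/-- The rescaled expected number of pairs of points with the nearest neighbour `x`. -/
lemma tendsto_lintegral_pairWeight [Nontrivial F] (hrel : IsComparison rel) (R : ℝ) :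
    Tendsto (fun N : ℕ => ((N : ℝ≥0∞) + 2) * (N + 1) *
      ∫⁻ y, ∫⁻ z, pairWeight μ rel (R * nnScale (finrank ℝ F) N) N x y z ∂μ ∂μ) atTop
      (𝓝 ((M.val * M.val : ℝ≥0) * ∫⁻ q, pairLimit M.lin M.val R q)) := by
  obtain ⟨ρ₀, hρ₀⟩ := (isBounded_norm_le M.lin R).subset_closedBall 0
  have hsupp : ∀ q, pairLimit M.lin M.val R q ≠ 0 → ‖q.1‖ ≤ ρ₀ ∧ ‖q.2‖ ≤ ρ₀ := by
    intro q hq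
    have : q ∈ pairRegion M.lin R := Set.mem_of_indicator_ne_zero hq
    exact ⟨mem_closedBall_zero_iff.1 (hρ₀ this.1), mem_closedBall_zero_iff.1 (hρ₀ this.2.1)⟩
  have key := M.tendsto_lintegral_lintegral (G := pairLimit M.lin M.val R) (K := R) (ρ₀ := ρ₀)
    (g := fun N q => pairWeight μ rel (R * nnScale (finrank ℝ F) N) N x q.1 q.2)
    (fun N => (measurable_pairWeight hrel _ N).comp (measurable_const.prodMk measurable_id))
    (fun N q => pairWeight_le_one _ _ _ _ _) ?_ hsupp ?_
  · -- The number of ordered pairs among `N + 2` points is asymptotic to `(N + 3) ^ 2`.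
    have hratio : Tendsto (fun N : ℕ => (((N : ℝ≥0∞) + 2) * (N + 1)) / (N + 3) ^ 2) atTop
        (𝓝 1) := by
      have h3 : Tendsto (fun N : ℕ => ((N : ℝ) + 3)⁻¹) atTop (𝓝 0) :=
        tendsto_inv_atTop_zero.comp
          (tendsto_atTop_add_const_right _ _ tendsto_natCast_atTop_atTop)
      have h4 : Tendsto (fun N : ℕ => (1 - ((N : ℝ) + 3)⁻¹) * (1 - 2 * ((N : ℝ) + 3)⁻¹)) atTop
          (𝓝 1) := by
        simpa using (h3.const_sub 1).mul ((h3.const_mul 2).const_sub 1)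
      have h5 := ENNReal.tendsto_ofReal h4
      rw [ENNReal.ofReal_one] at h5
      refine h5.congr fun N => ?_
      rw [show (1 - ((N : ℝ) + 3)⁻¹) * (1 - 2 * ((N : ℝ) + 3)⁻¹) =
        ((N + 2 : ℕ) * (N + 1 : ℕ) : ℝ) / ((N + 3 : ℕ) : ℝ) ^ 2 by
          push_cast; field_simp; ring]
      rw [ENNReal.ofReal_div_of_pos (by positivity), ENNReal.ofReal_mul (by positivity),
        ENNReal.ofReal_pow (by positivity)]
      simp only [ENNReal.ofReal_natCast]
      push_cast
      rfl
    have := ENNReal.Tendsto.mul hratio (Or.inl one_ne_zero) key (Or.inr ENNReal.one_ne_top)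
    rw [one_mul] at this
    refine this.congr fun N => ?_
    rw [← mul_assoc, ENNReal.div_mul_cancel (by simp) (by finiteness)]
  · intro N q hq
    have : PairCond rel (R * nnScale (finrank ℝ F) N) x q.1 q.2 := by
      by_contra h
      simp [pairWeight, h] at hq
    exact ⟨this.1, this.2.1⟩
  · -- Off the boundary of the limit region, which is null, the conditions on the pair stabilize.
    have e1 : ∀ᵐ q : F × F, ‖M.lin q.1‖ ≠ R :=
      Measure.quasiMeasurePreserving_fst.ae (ae_norm_ne M.lin R)
    have e2 : ∀ᵐ q : F × F, ‖M.lin q.2‖ ≠ R :=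
      Measure.quasiMeasurePreserving_snd.ae (ae_norm_ne M.lin R)
    have e3 : ∀ᵐ q : F × F, ‖M.lin q.1 - M.lin q.2‖ ≠ ‖M.lin q.1‖ := by
      rw [ae_iff, Measure.volume_eq_prod, Measure.measure_prod_null]
      · refine ae_of_all _ fun u => ?_
        exact ae_iff.1 (ae_norm_sub_ne M.lin (M.lin u) ‖M.lin u‖)
      · simp only [ne_eq, not_not]
        exact measurableSet_eq_fun (by fun_prop) (by fun_prop)
    have e4 : ∀ᵐ q : F × F, ‖M.lin q.2 - M.lin q.1‖ ≠ ‖M.lin q.2‖ :=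
      (Measure.measurePreserving_swap (μ := (volume : Measure F))
        (ν := (volume : Measure F))).quasiMeasurePreserving.ae e3
    filter_upwards [e1, e2, e3, e4] with q h1 h2 h3 h4
    have hR : Tendsto (fun N => R * nnScale (finrank ℝ F) N / nnScale (finrank ℝ F) N) atTop
        (𝓝 R) :=
      tendsto_const_nhds.congr fun N => (mul_div_cancel_right₀ _ (nnScale_pos _ N).ne').symm
    have hev : ∀ᶠ N in atTop, (PairCond rel (R * nnScale (finrank ℝ F) N) x (M.zoom N q.1)
        (M.zoom N q.2) ↔ q ∈ pairRegion M.lin R) := by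
      filter_upwards [isComparison_le.eventually_iff (nnScale_pos _)
          (M.tendsto_dist_zoom_base q.1) hR h1,
        isComparison_le.eventually_iff (nnScale_pos _) (M.tendsto_dist_zoom_base q.2) hR h2,
        hrel.eventually_iff (nnScale_pos _) (M.tendsto_dist_zoom_base q.1)
          (M.tendsto_dist_zoom q.1 q.2) h3.symm,
        hrel.eventually_iff (nnScale_pos _) (M.tendsto_dist_zoom_base q.2)
          (M.tendsto_dist_zoom q.2 q.1) h4.symm] with N g1 g2 g3 g4
      rw [PairCond, g1, g2, g3, g4, pairRegion, Set.mem_ofPred_eq, h1.le_iff_lt, h2.le_iff_lt]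
    by_cases hq : q ∈ pairRegion M.lin R
    · rw [pairLimit, Set.indicator_of_mem hq]
      refine (M.tendsto_measure_freeSet_pow hrel q.1 q.2).congr' ?_
      filter_upwards [hev] with N hN
      simp [pairWeight, hN.2 hq]
    · rw [pairLimit, Set.indicator_of_notMem hq]
      refine tendsto_const_nhds.congr' ?_
      filter_upwards [hev] with N hN
      simp [pairWeight, mt hN.1 hq]

end LocalModel

end Limit

/-! ### Identification of the limit -/

section Identify

lemma measurable_tripleIntegrand (m : ℕ) : Measurable (tripleIntegrand m) := by
  have hm : MeasurableSet {q : (EuclideanSpace ℝ (Fin m) × EuclideanSpace ℝ (Fin m)) ×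
      EuclideanSpace ℝ (Fin m) | q.2 ∈ ball q.1.1 ‖q.1.1‖ ∪ ball q.1.2 ‖q.1.2‖} := by
    have h1 : MeasurableSet {q : (EuclideanSpace ℝ (Fin m) × EuclideanSpace ℝ (Fin m)) ×
        EuclideanSpace ℝ (Fin m) | dist q.2 q.1.1 < ‖q.1.1‖} :=
      measurableSet_lt (by fun_prop) (by fun_prop)
    have h2 : MeasurableSet {q : (EuclideanSpace ℝ (Fin m) × EuclideanSpace ℝ (Fin m)) ×
        EuclideanSpace ℝ (Fin m) | dist q.2 q.1.2 < ‖q.1.2‖} :=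
      measurableSet_lt (by fun_prop) (by fun_prop)
    exact h1.union h2
  have := (measurable_measure_prodMk_left
    (ν := (volume : Measure (EuclideanSpace ℝ (Fin m)))) hm).ennreal_toReal
  exact (Real.measurable_exp.comp this.neg)

lemma measurableSet_tripleRegion (m : ℕ) : MeasurableSet (tripleRegion m) :=
  measurableSet_lt (by fun_prop) (by fun_prop)

/-- The limit constant, as a lower Lebesgue integral. -/
noncomputable def tripleLConst (m : ℕ) : ℝ≥0∞ :=
  ∫⁻ w in tripleRegion m, ENNReal.ofReal (tripleIntegrand m w)

/-- A multiple of `T` carries `p` times the Lebesgue measure to the Lebesgue measure. Together with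
the invariance of the pair conditions under dilations, this absorbs both the density and the metric
differential of a local model. -/
lemma exists_measurePreserving_smul {F : Type*} [NormedAddCommGroup F] [NormedSpace ℝ F]
    [FiniteDimensional ℝ F] [Nontrivial F] [MeasureSpace F] [BorelSpace F]
    [(volume : Measure F).IsAddHaarMeasure] (T : F ≃L[ℝ] F) {p : ℝ≥0} (hp : 0 < p) :
    ∃ c : ℝ, 0 < c ∧
      MeasurePreserving (fun u => c • T u) ((p : ℝ≥0∞) • (volume : Measure F)) volume := by
  set D := finrank ℝ F
  have hD : D ≠ 0 := finrank_pos.ne'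
  set t := LinearMap.det (T : F →ₗ[ℝ] F)
  have ht : t ≠ 0 := by
    have := LinearEquiv.isUnit_det' T.toLinearEquiv
    exact this.ne_zero
  have hp' : (0 : ℝ) < p := hp
  have hq : 0 < p / |t| := by positivity
  refine ⟨(p / |t|) ^ (1 / (D : ℝ)), by positivity, by fun_prop, ?_⟩
  set c := ((p : ℝ) / |t|) ^ (1 / (D : ℝ))
  have hc : c ^ D = p / |t| := by
    rw [← Real.rpow_natCast, ← Real.rpow_mul hq.le, one_div_mul_cancel (by exact_mod_cast hD),
      Real.rpow_one]
  have hdet : LinearMap.det (c • (T : F →ₗ[ℝ] F)) = c ^ D * t := LinearMap.det_smul _ _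
  have hc0 : 0 < c := by positivity
  have h0 : LinearMap.det (c • (T : F →ₗ[ℝ] F)) ≠ 0 := by rw [hdet]; positivity
  have h := Measure.map_linearMap_addHaar_eq_smul_addHaar (volume : Measure F) h0
  have h2 : ⇑(c • (T : F →ₗ[ℝ] F)) = fun u => c • T u := rfl
  rw [h2] at h
  rw [Measure.map_smul, h, smul_smul, hdet, abs_inv, abs_mul, hc, abs_of_pos hq,
    div_mul_cancel₀ _ (abs_pos.2 ht).ne', ← ENNReal.ofReal_coe_nnreal,
    ← ENNReal.ofReal_mul hp'.le, mul_inv_cancel₀ hp'.ne', ENNReal.ofReal_one, one_smul]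

variable {m : ℕ}

/-- The limit of the rescaled pair counts does not depend on the density nor on the metric
differential, up to the cut-off. -/
lemma lintegral_pairLimit_eq (T : EuclideanSpace ℝ (Fin m) ≃L[ℝ] EuclideanSpace ℝ (Fin m))
    {p : ℝ≥0} {c : ℝ} (hc : 0 < c) (hT : MeasurePreserving (fun u => c • T u)
      ((p : ℝ≥0∞) • (volume : Measure (EuclideanSpace ℝ (Fin m)))) volume) (R : ℝ) :
    (p * p : ℝ≥0) * ∫⁻ q, pairLimit T p R q =
      ∫⁻ w, (tripleRegion m ∩ {w | ‖w.1‖ ≤ c * R ∧ ‖w.2‖ ≤ c * R}).indicator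
        (fun w => ENNReal.ofReal (tripleIntegrand m w)) w := by
  have hms : MeasurableSet {w : EuclideanSpace ℝ (Fin m) × EuclideanSpace ℝ (Fin m) |
      ‖w.1‖ ≤ c * R ∧ ‖w.2‖ ≤ c * R} := by
    have h1 : MeasurableSet {w : EuclideanSpace ℝ (Fin m) × EuclideanSpace ℝ (Fin m) |
      ‖w.1‖ ≤ c * R} := measurableSet_le (by fun_prop) (by fun_prop)
    have h2 : MeasurableSet {w : EuclideanSpace ℝ (Fin m) × EuclideanSpace ℝ (Fin m) |
      ‖w.2‖ ≤ c * R} := measurableSet_le (by fun_prop) (by fun_prop)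
    exact h1.inter h2
  have hT2 := hT.prod hT
  have hnorm : ∀ u, ‖c • u‖ = c * ‖u‖ := fun u : EuclideanSpace ℝ (Fin m) => by
    rw [norm_smul, Real.norm_of_nonneg hc.le]
  have hmul : ∀ a b : ℝ, c * a < c * b ↔ a < b := fun a b => mul_lt_mul_iff_right₀ hc
  have hmul' : ∀ a b : ℝ, c * a ≤ c * b ↔ a ≤ b := fun a b => mul_le_mul_iff_right₀ hc
  rw [Measure.volume_eq_prod, ← hT2.lintegral_comp
    ((measurable_tripleIntegrand m).ennreal_ofReal.indicator
      ((measurableSet_tripleRegion m).inter hms)), Measure.prod_smul_left, Measure.prod_smul_right,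
    lintegral_smul_measure, lintegral_smul_measure, smul_eq_mul, smul_eq_mul, ← mul_assoc]
  push_cast
  congr 1
  refine lintegral_congr fun q => ?_
  obtain ⟨u, v⟩ := q
  have hiff : (u, v) ∈ pairRegion T R ↔ Prod.map (fun u => c • T u) (fun u => c • T u) (u, v) ∈
      tripleRegion m ∩ {w | ‖w.1‖ ≤ c * R ∧ ‖w.2‖ ≤ c * R} := by
    simp only [pairRegion, tripleRegion, Set.mem_inter_iff, Set.mem_ofPred_eq, Prod.map_apply,
      ← smul_sub, hnorm, hmul', max_lt_iff, hmul]
    rw [norm_sub_rev (T v) (T u)]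
    tauto
  have hset : ballUnion T u v = (fun u => c • T u) ⁻¹'
      (ball (c • T u) ‖c • T u‖ ∪ ball (c • T v) ‖c • T v‖) := by
    ext w
    simp only [ballUnion, Set.mem_ofPred_eq, Set.mem_preimage, Set.mem_union, mem_ball,
      dist_eq_norm, ← smul_sub, hnorm, hmul]
    rw [norm_sub_rev (T w) (T u), norm_sub_rev (T w) (T v)]
  have hvol : (p : ℝ≥0∞) * volume (ballUnion T u v) =
      volume (ball (c • T u) ‖c • T u‖ ∪ ball (c • T v) ‖c • T v‖) := by
    rw [← hT.measure_preimage (measurableSet_ball.union measurableSet_ball).nullMeasurableSet,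
      ← hset]
    rfl
  by_cases h : (u, v) ∈ pairRegion T R
  · rw [pairLimit, Set.indicator_of_mem h, Set.indicator_of_mem (hiff.1 h)]
    simp only [tripleIntegrand, Prod.map_apply, hvol]
  · rw [pairLimit, Set.indicator_of_notMem h, Set.indicator_of_notMem (mt hiff.2 h)]

/-- Removing the cut-off. -/
lemma tendsto_lintegral_pairLimit [Nontrivial (EuclideanSpace ℝ (Fin m))]
    (T : EuclideanSpace ℝ (Fin m) ≃L[ℝ] EuclideanSpace ℝ (Fin m)) {p : ℝ≥0} (hp : 0 < p) :
    Tendsto (fun R : ℕ => (p * p : ℝ≥0) * ∫⁻ q, pairLimit T p R q) atTop (𝓝 (tripleLConst m)) := by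
  obtain ⟨c, hc, hT⟩ := exists_measurePreserving_smul T hp
  simp only [lintegral_pairLimit_eq T hc hT]
  rw [tripleLConst, ← lintegral_indicator (measurableSet_tripleRegion m)]
  refine lintegral_tendsto_of_tendsto_of_monotone (fun R => ?_) (ae_of_all _ fun w => ?_)
    (ae_of_all _ fun w => ?_)
  · have h1 : MeasurableSet {w : EuclideanSpace ℝ (Fin m) × EuclideanSpace ℝ (Fin m) |
      ‖w.1‖ ≤ c * R} := measurableSet_le (by fun_prop) (by fun_prop)
    have h2 : MeasurableSet {w : EuclideanSpace ℝ (Fin m) × EuclideanSpace ℝ (Fin m) |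
      ‖w.2‖ ≤ c * R} := measurableSet_le (by fun_prop) (by fun_prop)
    exact ((measurable_tripleIntegrand m).ennreal_ofReal.indicator
      ((measurableSet_tripleRegion m).inter (h1.inter h2))).aemeasurable
  · intro R R' hR
    refine Set.indicator_le_indicator_of_subset ?_ (fun _ => zero_le) w
    refine Set.inter_subset_inter_right _ fun w hw => ?_
    have : c * R ≤ c * (R' : ℝ) := by gcongr
    exact ⟨hw.1.trans this, hw.2.trans this⟩
  · refine tendsto_const_nhds.congr' ?_
    have hbig : Tendsto (fun R : ℕ => c * (R : ℝ)) atTop atTop :=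
      tendsto_natCast_atTop_atTop.const_mul_atTop hc
    filter_upwards [hbig.eventually_ge_atTop (max ‖w.1‖ ‖w.2‖)] with R hR
    have hw : w ∈ {w : EuclideanSpace ℝ (Fin m) × EuclideanSpace ℝ (Fin m) |
        ‖w.1‖ ≤ c * R ∧ ‖w.2‖ ≤ c * R} :=
      ⟨(le_max_left _ _).trans hR, (le_max_right _ _).trans hR⟩
    by_cases h : w ∈ tripleRegion m
    · have hw' : w ∈ tripleRegion m ∩ {w | ‖w.1‖ ≤ c * R ∧ ‖w.2‖ ≤ c * R} := ⟨h, hw⟩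
      rw [Set.indicator_of_mem h, Set.indicator_of_mem hw']
    · rw [Set.indicator_of_notMem h, Set.indicator_of_notMem (fun h2 => h h2.1)]

/-- The limiting probability that no point lies within distance `R` vanishes as `R → ∞`. -/
lemma tendsto_exp_neg_volume {F : Type*} [NormedAddCommGroup F] [NormedSpace ℝ F]
    [FiniteDimensional ℝ F] [Nontrivial F] [MeasureSpace F] [BorelSpace F]
    [(volume : Measure F).IsAddHaarMeasure] (T : F ≃L[ℝ] F) {p : ℝ≥0} (hp : 0 < p) :
    Tendsto (fun R : ℕ => ENNReal.ofReal
      (Real.exp (-((p : ℝ≥0∞) * volume {w | ‖T w‖ ≤ (R : ℝ)}).toReal))) atTop (𝓝 0) := by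
  have h1 : Tendsto (fun R : ℕ => volume {w | ‖T w‖ ≤ (R : ℝ)}) atTop (𝓝 ⊤) := by
    have hmono : Monotone fun R : ℕ => {w | ‖T w‖ ≤ (R : ℝ)} := by
      intro R R' h w hw
      exact (show ‖T w‖ ≤ (R : ℝ) from hw).trans (by exact_mod_cast h)
    have h := tendsto_measure_iUnion_atTop (μ := (volume : Measure F)) hmono
    have hU : ⋃ R : ℕ, {w | ‖T w‖ ≤ (R : ℝ)} = Set.univ := by
      refine Set.eq_univ_of_forall fun w => ?_
      obtain ⟨R, hR⟩ := exists_nat_ge ‖T w‖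
      exact Set.mem_iUnion.2 ⟨R, hR⟩
    have : NoncompactSpace F := NormedSpace.noncompactSpace ℝ F
    rwa [hU, measure_univ_of_isAddLeftInvariant] at h
  have h2 : Tendsto (fun R : ℕ => (p : ℝ≥0∞) * volume {w | ‖T w‖ ≤ (R : ℝ)}) atTop (𝓝 ⊤) := by
    have := ENNReal.Tendsto.const_mul (a := (p : ℝ≥0∞)) h1 (Or.inl ENNReal.top_ne_zero)
    rwa [ENNReal.mul_top (by exact_mod_cast hp.ne')] at this
  have h3 : Tendsto (fun R : ℕ => ((p : ℝ≥0∞) * volume {w | ‖T w‖ ≤ (R : ℝ)}).toReal)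
      atTop atTop := by
    refine tendsto_atTop.2 fun b => ?_
    filter_upwards [h2.eventually_const_lt (ENNReal.ofReal_lt_top (r := b))] with R hR
    refine (ENNReal.ofReal_le_iff_le_toReal ?_).1 hR.le
    exact ENNReal.mul_ne_top ENNReal.coe_ne_top (isBounded_norm_le T R).measure_lt_top.ne
  have := ENNReal.tendsto_ofReal (Real.tendsto_exp_neg_atTop_nhds_zero.comp h3)
  rwa [ENNReal.ofReal_zero] at this

end Identify

/-! ### Counting pairs in a finite sample -/

section Count

variable {S : Type*} [MetricSpace S]

/-- In the sample that consists of `x` and of the points `y l`, the point `x` is a nearest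
neighbour of `y i` and of `y j`, at distance at most `r`. -/
def PairEvent (rel : ℝ → ℝ → Prop) (r : ℝ) {n : ℕ} (x : S) (y : Fin n → S) (i j : Fin n) : Prop :=
  i ≠ j ∧ PairCond rel r x (y i) (y j) ∧
    ∀ l, l ≠ i → l ≠ j → y l ∈ freeSet rel x (y i) (y j)

open scoped Classical in
/-- The number of ordered pairs among the points `y l` that have `x` as a nearest neighbour, at
distance at most `r`. -/
noncomputable def pairCount (rel : ℝ → ℝ → Prop) (r : ℝ) {n : ℕ} (x : S) (y : Fin n → S) : ℝ≥0∞ :=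
  ∑ i, ∑ j, if PairEvent rel r x y i j then 1 else 0

/-- All points of the sample `y` other than `y i` are at distance more than `r` from `y i`. -/
def IsFar (r : ℝ) {n : ℕ} (y : Fin n → S) (i : Fin n) : Prop :=
  ∀ l, l ≠ i → r < dist (y i) (y l)

/-- Any point `x` of `S` is a nearest neighbour, possibly with ties, of at most `K` points of a
sample of points other than `x`. -/
def HasKissingBound (S : Type*) [MetricSpace S] (K : ℕ) : Prop :=
  ∀ (x : S) (n : ℕ) (y : Fin n → S) (s : Finset (Fin n)), (∀ i ∈ s, y i ≠ x) →
    (∀ i ∈ s, ∀ j ∈ s, i ≠ j → dist (y i) x ≤ dist (y i) (y j)) → s.card ≤ K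

variable {rel : ℝ → ℝ → Prop} {n : ℕ}

lemma pairCount_le (hrel : IsComparison rel) {K : ℕ} (hK : HasKissingBound S K) (r : ℝ) {x : S}
    {y : Fin n → S} (hy : ∀ i, y i ≠ x) : pairCount rel r x y ≤ (K : ℝ≥0∞) * K := by
  classical
  set s : Finset (Fin n) := Finset.univ.filter fun i => ∀ l, l ≠ i → dist (y i) x ≤ dist (y i) (y l)
  have hs : s.card ≤ K := hK x n y s (fun i _ => hy i) fun i hi j _ hij =>
    (Finset.mem_filter.1 hi).2 j hij.symm
  have hmem : ∀ i j, PairEvent rel r x y i j → i ∈ s ∧ j ∈ s := by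
    rintro i j ⟨hij, ⟨-, -, h3, h4⟩, h5⟩
    refine ⟨Finset.mem_filter.2 ⟨Finset.mem_univ _, fun l hl => ?_⟩,
      Finset.mem_filter.2 ⟨Finset.mem_univ _, fun l hl => ?_⟩⟩
    · by_cases hlj : l = j
      · rw [hlj]; exact hrel.le h3
      · exact hrel.le (h5 l hl hlj).1
    · by_cases hli : l = i
      · rw [hli]; exact hrel.le h4
      · exact hrel.le (h5 l hli hl).2
  calc pairCount rel r x y
      ≤ ∑ i, ∑ j, (if i ∈ s then (1 : ℝ≥0∞) else 0) * (if j ∈ s then 1 else 0) := by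
        refine Finset.sum_le_sum fun i _ => Finset.sum_le_sum fun j _ => ?_
        by_cases h : PairEvent rel r x y i j
        · simp [h, hmem i j h]
        · simp [h]
    _ = (s.card : ℝ≥0∞) * s.card := by
        rw [← Finset.sum_mul_sum]; simp
    _ ≤ _ := by gcongr

/-- The triples, sorted by the common target `k`; the sources are indexed by the complement of
`k`. -/
lemma numTriples_eq_sum (N : Fin (n + 1) → Fin (n + 1)) :
    (numTriples N : ℝ≥0∞) = ∑ k, ∑ i, ∑ j,
      if i ≠ j ∧ N (k.succAbove i) = k ∧ N (k.succAbove j) = k then 1 else 0 := by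
  have h1 : (numTriples N : ℝ≥0∞) = ∑ k, ∑ i, ∑ j,
      if i ≠ j ∧ i ≠ k ∧ j ≠ k ∧ N i = k ∧ N j = k then 1 else 0 := by
    rw [numTriples, Finset.card_filter]
    push_cast
    simp only [Fintype.sum_prod_type]
    calc _ = ∑ i, ∑ k, ∑ j, if i ≠ j ∧ i ≠ k ∧ j ≠ k ∧ N i = k ∧ N j = k then (1 : ℝ≥0∞) else 0 :=
          Finset.sum_congr rfl fun i _ => Finset.sum_comm
      _ = _ := Finset.sum_comm
  rw [h1]
  refine Finset.sum_congr rfl fun k _ => ?_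
  rw [Fin.sum_univ_succAbove _ k]
  simp only [ne_eq, not_true_eq_false, false_and, and_false, if_false, Finset.sum_const_zero,
    zero_add]
  refine Finset.sum_congr rfl fun i _ => ?_
  rw [Fin.sum_univ_succAbove _ k]
  simp [Fin.succAbove_ne]

section Sandwich

variable {x : Fin (n + 1) → S} {N : Fin (n + 1) → Fin (n + 1)}

/-- Pairs with a strict nearest neighbour are counted, no matter how ties are broken. -/
lemma sum_pairCount_le_numTriples (hN : ∀ i, IsNearestNeighbor x i (N i)) (r : ℝ) :
    ∑ k, pairCount (fun a b => a < b) r (x k) (k.removeNth x) ≤ (numTriples N : ℝ≥0∞) := by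
  classical
  have hstep : ∀ (k : Fin (n + 1)) (i j : Fin n),
      dist (x (k.succAbove i)) (x k) < dist (x (k.succAbove i)) (x (k.succAbove j)) →
      (∀ l, l ≠ i → l ≠ j →
        dist (x (k.succAbove i)) (x k) < dist (x (k.succAbove i)) (x (k.succAbove l))) →
      N (k.succAbove i) = k := by
    intro k i j h1 h2
    by_contra hne
    obtain ⟨l, hl⟩ := Fin.exists_succAbove_eq hne
    have h3 := hN (k.succAbove i)
    have h4 := h3.2 k (Fin.succAbove_ne k i).symm
    have h5 := h3.1
    rw [← hl] at h4 h5
    have hli : l ≠ i := fun h => h5 (by rw [h])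
    by_cases hlj : l = j
    · rw [hlj] at h4; exact h4.not_gt h1
    · exact h4.not_gt (h2 l hli hlj)
  rw [numTriples_eq_sum]
  refine Finset.sum_le_sum fun k _ => Finset.sum_le_sum fun i _ => Finset.sum_le_sum fun j _ => ?_
  split_ifs with h1 h2
  · exact le_rfl
  · refine absurd ?_ h2
    obtain ⟨hij, ⟨-, -, h3, h4⟩, h5⟩ := h1
    exact ⟨hij, hstep k i j h3 fun l hl hl' => (h5 l hl hl').1,
      hstep k j i h4 fun l hl hl' => (h5 l hl' hl).2⟩
  · exact zero_le
  · exact le_rfl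

open scoped Classical in
/-- The in-degrees are at most the kissing bound. Distinctness of the sample points matters: any
number of coinciding points could share a nearest neighbour. -/
lemma card_filter_eq_le {K : ℕ} (hK : HasKissingBound S K) (hx : Function.Injective x)
    (hN : ∀ i, IsNearestNeighbor x i (N i)) (k : Fin (n + 1)) :
    (Finset.univ.filter fun j => N j = k).card ≤ K := by
  refine hK (x k) (n + 1) x _ (fun i hi h => ?_) fun i hi j _ hij => ?_
  · have h1 := (Finset.mem_filter.1 hi).2
    exact (hN i).1 (h1.trans (hx h).symm)
  · have h1 := (Finset.mem_filter.1 hi).2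
    have := (hN i).2 j hij.symm
    rwa [h1] at this

open scoped Classical in
/-- The pairs of edges with a common target for which the first source is far from its nearest
neighbour are at most `K` times as many as the far points. -/
lemma sum_isFar_le {K : ℕ} (hK : HasKissingBound S K) (hx : Function.Injective x)
    (hN : ∀ i, IsNearestNeighbor x i (N i)) (r : ℝ) :
    ∑ k, ∑ i, ∑ j, (if N i = k ∧ N j = k ∧ IsFar r x i then (1 : ℝ≥0∞) else 0) ≤
      K * ∑ i, if IsFar r x i then 1 else 0 := by
  rw [Finset.sum_comm, Finset.mul_sum]
  refine Finset.sum_le_sum fun i _ => ?_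
  rw [Finset.sum_comm]
  by_cases h : IsFar r x i
  · have h2 : ∀ j, ∑ k, (if N i = k ∧ N j = k ∧ IsFar r x i then (1 : ℝ≥0∞) else 0) =
        if N j = N i then 1 else 0 := by
      intro j
      simp only [h, and_true, ite_and, Finset.sum_ite_eq, Finset.mem_univ, if_true]
    rw [Finset.sum_congr rfl fun j _ => h2 j, if_pos h, mul_one, Finset.sum_boole]
    exact_mod_cast card_filter_eq_le hK hx hN (N i)
  · simp [h]

open scoped Classical in
/-- The count of triples is at most the count of pairs with a nearest neighbour in the weak sense,
up to an error from points with a far nearest neighbour. -/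
lemma numTriples_le {K : ℕ} (hK : HasKissingBound S K) (hx : Function.Injective x)
    (hN : ∀ i, IsNearestNeighbor x i (N i)) (r : ℝ) :
    (numTriples N : ℝ≥0∞) ≤ ∑ k, pairCount (fun a b => a ≤ b) r (x k) (k.removeNth x) +
      2 * K * ∑ i, if IsFar r x i then 1 else 0 := by
  have hfar : ∀ (k : Fin (n + 1)) (f : Fin (n + 1) → ℝ≥0∞),
      ∑ i, f (k.succAbove i) ≤ ∑ i, f i := fun k f => by
    rw [Fin.sum_univ_succAbove f k]; exact le_add_self
  have hterm : ∀ (k : Fin (n + 1)) (i j : Fin n),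
      (if i ≠ j ∧ N (k.succAbove i) = k ∧ N (k.succAbove j) = k then (1 : ℝ≥0∞) else 0) ≤
      (if PairEvent (fun a b => a ≤ b) r (x k) (k.removeNth x) i j then 1 else 0) +
      (if N (k.succAbove i) = k ∧ N (k.succAbove j) = k ∧ IsFar r x (k.succAbove i)
        then 1 else 0) +
      (if N (k.succAbove j) = k ∧ N (k.succAbove i) = k ∧ IsFar r x (k.succAbove j)
        then 1 else 0) := by
    intro k i j
    by_cases h : i ≠ j ∧ N (k.succAbove i) = k ∧ N (k.succAbove j) = k
    swap
    · rw [if_neg h]; exact zero_le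
    obtain ⟨hij, hi, hj⟩ := h
    have hni := hN (k.succAbove i)
    have hnj := hN (k.succAbove j)
    rw [hi] at hni
    rw [hj] at hnj
    by_cases h1 : dist (x (k.succAbove i)) (x k) ≤ r
    swap
    · have : IsFar r x (k.succAbove i) := fun l hl => (not_le.1 h1).trans_le (hni.2 l hl)
      simp only [hi, hj, this, hij, ne_eq, not_false_eq_true, and_self, if_true]
      exact le_add_right le_add_self
    by_cases h2 : dist (x (k.succAbove j)) (x k) ≤ r
    swap
    · have : IsFar r x (k.succAbove j) := fun l hl => (not_le.1 h2).trans_le (hnj.2 l hl)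
      simp only [hi, hj, this, hij, ne_eq, not_false_eq_true, and_self, if_true]
      exact le_add_self
    have hne : ∀ {l l' : Fin n}, l ≠ l' → k.succAbove l ≠ k.succAbove l' := fun h h' =>
      h (Fin.succAbove_right_injective h')
    have : PairEvent (fun a b => a ≤ b) r (x k) (k.removeNth x) i j :=
      ⟨hij, ⟨h1, h2, hni.2 _ (hne hij.symm), hnj.2 _ (hne hij)⟩,
        fun l hl hl' => ⟨hni.2 _ (hne hl), hnj.2 _ (hne hl')⟩⟩
    rw [if_pos this, add_assoc]
    refine le_trans ?_ le_self_add
    split_ifs <;> simp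
  have h1 : ∑ k : Fin (n + 1), ∑ i : Fin n, ∑ j : Fin n,
      (if N (k.succAbove i) = k ∧ N (k.succAbove j) = k ∧ IsFar r x (k.succAbove i)
        then (1 : ℝ≥0∞) else 0) ≤ K * ∑ i, if IsFar r x i then 1 else 0 := by
    refine le_trans (Finset.sum_le_sum fun k _ => ?_) (sum_isFar_le hK hx hN r)
    refine le_trans (Finset.sum_le_sum fun i _ => hfar k (fun j =>
      if N (k.succAbove i) = k ∧ N j = k ∧ IsFar r x (k.succAbove i) then (1 : ℝ≥0∞) else 0)) ?_
    exact hfar k (fun i => ∑ j, if N i = k ∧ N j = k ∧ IsFar r x i then (1 : ℝ≥0∞) else 0)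
  have h2 : ∑ k : Fin (n + 1), ∑ i : Fin n, ∑ j : Fin n,
      (if N (k.succAbove j) = k ∧ N (k.succAbove i) = k ∧ IsFar r x (k.succAbove j)
        then (1 : ℝ≥0∞) else 0) ≤ K * ∑ i, if IsFar r x i then 1 else 0 := by
    refine le_trans (le_of_eq ?_) h1
    exact Finset.sum_congr rfl fun k _ => Finset.sum_comm
  rw [numTriples_eq_sum]
  calc _ ≤ _ := Finset.sum_le_sum fun k _ => Finset.sum_le_sum fun i _ =>
        Finset.sum_le_sum fun j _ => hterm k i j
    _ = ∑ k, pairCount (fun a b => a ≤ b) r (x k) (k.removeNth x) + _ + _ := by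
        simp only [Finset.sum_add_distrib, pairCount]
    _ ≤ _ := add_le_add (add_le_add le_rfl h1) h2
    _ = _ := by ring

end Sandwich

/-! ### Expected counts -/

variable [MeasurableSpace S] [BorelSpace S] [SecondCountableTopology S]

lemma measurableSet_pairEvent (hrel : IsComparison rel) (r : ℝ) (i j : Fin n) :
    MeasurableSet {q : S × (Fin n → S) | PairEvent rel r q.1 q.2 i j} := by
  have h1 : MeasurableSet {q : S × (Fin n → S) | PairCond rel r q.1 (q.2 i) (q.2 j)} :=
    (measurableSet_pairCond hrel r).preimage (by fun_prop :
      Measurable fun q : S × (Fin n → S) => (q.1, q.2 i, q.2 j))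
  have h2 : ∀ l, MeasurableSet {q : S × (Fin n → S) |
      q.2 l ∈ freeSet rel q.1 (q.2 i) (q.2 j)} := fun l =>
    (measurableSet_freeSet_prod hrel).preimage (by fun_prop :
      Measurable fun q : S × (Fin n → S) => ((q.1, q.2 i, q.2 j), q.2 l))
  have : {q : S × (Fin n → S) | PairEvent rel r q.1 q.2 i j} =
      {_q | i ≠ j} ∩ ({q | PairCond rel r q.1 (q.2 i) (q.2 j)} ∩
        ⋂ l, ⋂ _ : l ≠ i, ⋂ _ : l ≠ j, {q | q.2 l ∈ freeSet rel q.1 (q.2 i) (q.2 j)}) := by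
    ext q; simp [PairEvent]
  rw [this]
  exact (MeasurableSet.const _).inter (h1.inter (MeasurableSet.iInter fun l =>
    MeasurableSet.iInter fun _ => MeasurableSet.iInter fun _ => h2 l))

lemma measurable_pairCount (hrel : IsComparison rel) (r : ℝ) :
    Measurable fun q : S × (Fin n → S) => pairCount rel r q.1 q.2 := by
  unfold pairCount
  exact Finset.measurable_sum _ fun i _ => Finset.measurable_sum _ fun j _ =>
    Measurable.ite (measurableSet_pairEvent hrel r i j) measurable_const measurable_const

variable {μ : Measure S} [IsProbabilityMeasure μ]

/-- The probability of a pair event, by splitting off the two points of the pair. -/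
lemma measure_pairEvent {N : ℕ} (hrel : IsComparison rel) (r : ℝ) (x : S) {i j : Fin (N + 2)}
    (hij : i ≠ j) :
    Measure.pi (fun _ : Fin (N + 2) => μ) {y | PairEvent rel r x y i j} =
      ∫⁻ y, ∫⁻ z, pairWeight μ rel r N x y z ∂μ ∂μ := by
  obtain ⟨j', rfl⟩ := Fin.exists_succAbove_eq hij.symm
  have hm1 : MeasurableSet {q : S × (Fin (N + 1) → S) | PairCond rel r x q.1 (q.2 j') ∧
      ∀ l, l ≠ j' → q.2 l ∈ freeSet rel x q.1 (q.2 j')} := by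
    have h1 : MeasurableSet {q : S × (Fin (N + 1) → S) | PairCond rel r x q.1 (q.2 j')} :=
      (measurableSet_pairCond hrel r).preimage (by fun_prop :
        Measurable fun q : S × (Fin (N + 1) → S) => (x, q.1, q.2 j'))
    have h2 : ∀ l, MeasurableSet {q : S × (Fin (N + 1) → S) |
        q.2 l ∈ freeSet rel x q.1 (q.2 j')} := fun l =>
      (measurableSet_freeSet_prod hrel).preimage (by fun_prop :
        Measurable fun q : S × (Fin (N + 1) → S) => ((x, q.1, q.2 j'), q.2 l))
    have : {q : S × (Fin (N + 1) → S) | PairCond rel r x q.1 (q.2 j') ∧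
        ∀ l, l ≠ j' → q.2 l ∈ freeSet rel x q.1 (q.2 j')} =
        {q | PairCond rel r x q.1 (q.2 j')} ∩
          ⋂ l, ⋂ _ : l ≠ j', {q | q.2 l ∈ freeSet rel x q.1 (q.2 j')} := by
      ext q; simp
    rw [this]
    exact h1.inter (MeasurableSet.iInter fun l => MeasurableSet.iInter fun _ => h2 l)
  have e1 : {y : Fin (N + 2) → S | PairEvent rel r x y i (i.succAbove j')} =
      MeasurableEquiv.piFinSuccAbove (fun _ => S) i ⁻¹'
        {q : S × (Fin (N + 1) → S) | PairCond rel r x q.1 (q.2 j') ∧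
          ∀ l, l ≠ j' → q.2 l ∈ freeSet rel x q.1 (q.2 j')} := by
    ext y
    change PairEvent rel r x y i (i.succAbove j') ↔ PairCond rel r x (y i) (y (i.succAbove j')) ∧
      ∀ l, l ≠ j' → y (i.succAbove l) ∈ freeSet rel x (y i) (y (i.succAbove j'))
    rw [PairEvent, Fin.forall_iff_succAbove i]
    simp [Fin.succAbove_ne, hij]
  rw [e1, (measurePreserving_piFinSuccAbove (fun _ => μ) i).measure_preimage_equiv,
    Measure.prod_apply hm1]
  refine lintegral_congr fun a => ?_
  have hm2 : MeasurableSet {q : S × (Fin N → S) | PairCond rel r x a q.1 ∧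
      ∀ l, q.2 l ∈ freeSet rel x a q.1} := by
    have h1 : MeasurableSet {q : S × (Fin N → S) | PairCond rel r x a q.1} :=
      (measurableSet_pairCond hrel r).preimage (by fun_prop :
        Measurable fun q : S × (Fin N → S) => (x, a, q.1))
    have h2 : ∀ l, MeasurableSet {q : S × (Fin N → S) | q.2 l ∈ freeSet rel x a q.1} := fun l =>
      (measurableSet_freeSet_prod hrel).preimage (by fun_prop :
        Measurable fun q : S × (Fin N → S) => ((x, a, q.1), q.2 l))
    have : {q : S × (Fin N → S) | PairCond rel r x a q.1 ∧ ∀ l, q.2 l ∈ freeSet rel x a q.1} =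
        {q | PairCond rel r x a q.1} ∩ ⋂ l, {q | q.2 l ∈ freeSet rel x a q.1} := by
      ext q; simp
    rw [this]
    exact h1.inter (MeasurableSet.iInter h2)
  have e2 : Prod.mk a ⁻¹' {q : S × (Fin (N + 1) → S) | PairCond rel r x q.1 (q.2 j') ∧
          ∀ l, l ≠ j' → q.2 l ∈ freeSet rel x q.1 (q.2 j')} =
      MeasurableEquiv.piFinSuccAbove (fun _ => S) j' ⁻¹'
        {q : S × (Fin N → S) | PairCond rel r x a q.1 ∧ ∀ l, q.2 l ∈ freeSet rel x a q.1} := by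
    ext y
    change (PairCond rel r x a (y j') ∧ ∀ l, l ≠ j' → y l ∈ freeSet rel x a (y j')) ↔
      (PairCond rel r x a (y j') ∧ ∀ l, y (j'.succAbove l) ∈ freeSet rel x a (y j'))
    rw [Fin.forall_iff_succAbove j']
    simp [Fin.succAbove_ne]
  rw [e2, (measurePreserving_piFinSuccAbove (fun _ => μ) j').measure_preimage_equiv,
    Measure.prod_apply hm2]
  refine lintegral_congr fun b => ?_
  by_cases hab : PairCond rel r x a b
  · have : Prod.mk b ⁻¹' {q : S × (Fin N → S) | PairCond rel r x a q.1 ∧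
        ∀ l, q.2 l ∈ freeSet rel x a q.1} = Set.univ.pi fun _ => freeSet rel x a b := by
      ext y; simp [hab]
    rw [this, Measure.pi_pi, pairWeight, if_pos hab]
    simp
  · have : Prod.mk b ⁻¹' {q : S × (Fin N → S) | PairCond rel r x a q.1 ∧
        ∀ l, q.2 l ∈ freeSet rel x a q.1} = ∅ := by
      ext y; simp [hab]
    rw [this, measure_empty, pairWeight, if_neg hab]

/-- The expected number of pairs with the nearest neighbour `x`, in a sample that consists of `x`
and of `N + 2` random points. -/
noncomputable def meanPairCount (μ : Measure S) (rel : ℝ → ℝ → Prop) (r : ℝ) (N : ℕ) (x : S) :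
    ℝ≥0∞ :=
  ∫⁻ y, pairCount rel r x y ∂(Measure.pi fun _ : Fin (N + 2) => μ)

lemma measurable_meanPairCount (hrel : IsComparison rel) (r : ℝ) (N : ℕ) :
    Measurable (meanPairCount μ rel r N) :=
  (measurable_pairCount hrel r).lintegral_prod_right'

lemma meanPairCount_eq (hrel : IsComparison rel) (r : ℝ) (N : ℕ) (x : S) :
    meanPairCount μ rel r N x =
      ((N : ℝ≥0∞) + 2) * (N + 1) * ∫⁻ y, ∫⁻ z, pairWeight μ rel r N x y z ∂μ ∂μ := by
  classical
  have hm : ∀ i j : Fin (N + 2), MeasurableSet {y : Fin (N + 2) → S | PairEvent rel r x y i j} :=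
    fun i j => (measurableSet_pairEvent hrel r i j).preimage
      (measurable_const.prodMk measurable_id : Measurable fun y : Fin (N + 2) → S => (x, y))
  have hint : ∀ i j : Fin (N + 2), ∫⁻ y, (if PairEvent rel r x y i j then (1 : ℝ≥0∞) else 0)
      ∂(Measure.pi fun _ : Fin (N + 2) => μ) =
      if i ≠ j then ∫⁻ y, ∫⁻ z, pairWeight μ rel r N x y z ∂μ ∂μ else 0 := by
    intro i j
    have : (fun y => if PairEvent rel r x y i j then (1 : ℝ≥0∞) else 0) =
        {y : Fin (N + 2) → S | PairEvent rel r x y i j}.indicator 1 := by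
      ext y; simp [Set.indicator_apply]
    rw [this, lintegral_indicator_one (hm i j)]
    split_ifs with h
    · exact measure_pairEvent hrel r x h
    · have : {y : Fin (N + 2) → S | PairEvent rel r x y i j} = ∅ := by
        ext y; simp [PairEvent, h]
      rw [this, measure_empty]
  have hm2 : ∀ i j : Fin (N + 2), Measurable fun y : Fin (N + 2) → S =>
      if PairEvent rel r x y i j then (1 : ℝ≥0∞) else 0 := fun i j =>
    Measurable.ite (hm i j) measurable_const measurable_const
  unfold meanPairCount pairCount
  rw [lintegral_finsetSum _ fun i _ => Finset.measurable_sum _ fun j _ => hm2 i j]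
  simp only [lintegral_finsetSum _ fun j _ => hm2 _ j, hint]
  have hcount : ∀ (i : Fin (N + 2)) (c : ℝ≥0∞), (∑ j, if i ≠ j then c else 0) = (N + 1) * c := by
    intro i c
    rw [Fin.sum_univ_succAbove _ i]
    simp [(Fin.succAbove_ne i _).symm]
  simp only [hcount, Finset.sum_const, Finset.card_univ, Fintype.card_fin, nsmul_eq_mul]
  push_cast
  ring

lemma ae_ne_of_measure_singleton {x : S} (hx : μ {x} = 0) (N : ℕ) :
    ∀ᵐ y ∂(Measure.pi fun _ : Fin N => μ), ∀ i, y i ≠ x := by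
  rw [ae_all_iff]
  intro i
  refine (measurePreserving_eval (fun _ => μ) i).quasiMeasurePreserving.ae
    (p := fun y => y ≠ x) ?_
  rw [ae_iff]
  simpa using hx

lemma meanPairCount_le (hrel : IsComparison rel) {K : ℕ} (hK : HasKissingBound S K) (r : ℝ)
    (N : ℕ) {x : S} (hx : μ {x} = 0) : meanPairCount μ rel r N x ≤ (K : ℝ≥0∞) * K := by
  calc meanPairCount μ rel r N x ≤ ∫⁻ _, (K : ℝ≥0∞) * K ∂(Measure.pi fun _ : Fin (N + 2) => μ) :=
        lintegral_mono_ae ((ae_ne_of_measure_singleton hx _).mono fun y hy =>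
          pairCount_le hrel hK r hy)
    _ = _ := by simp

lemma lintegral_pairCount_removeNth (hrel : IsComparison rel) (r : ℝ) (N : ℕ) (k : Fin (N + 3)) :
    ∫⁻ x, pairCount rel r (x k) (k.removeNth x) ∂(Measure.pi fun _ : Fin (N + 3) => μ) =
      ∫⁻ x, meanPairCount μ rel r N x ∂μ := by
  have h := (measurePreserving_piFinSuccAbove (fun _ : Fin (N + 3) => μ) k).lintegral_comp
    (measurable_pairCount (S := S) (n := N + 2) hrel r)
  refine Eq.trans ?_ (h.trans (lintegral_prod _ (measurable_pairCount hrel r).aemeasurable))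
  rfl

lemma measurableSet_isFar (r : ℝ) (i : Fin n) : MeasurableSet {x : Fin n → S | IsFar r x i} := by
  have : {x : Fin n → S | IsFar r x i} = ⋂ l, ⋂ _ : l ≠ i, {x | r < dist (x i) (x l)} := by
    ext q; simp [IsFar]
  rw [this]
  exact MeasurableSet.iInter fun l => MeasurableSet.iInter fun _ =>
    measurableSet_lt (by fun_prop) (by fun_prop)

lemma measure_isFar (r : ℝ) (N : ℕ) (i : Fin (N + 3)) :
    Measure.pi (fun _ : Fin (N + 3) => μ) {x | IsFar r x i} =
      ∫⁻ x, μ (closedBall x r)ᶜ ^ (N + 2) ∂μ := by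
  have hm : MeasurableSet {q : S × (Fin (N + 2) → S) | ∀ l, r < dist q.1 (q.2 l)} := by
    have : {q : S × (Fin (N + 2) → S) | ∀ l, r < dist q.1 (q.2 l)} =
        ⋂ l, {q | r < dist q.1 (q.2 l)} := by ext q; simp
    rw [this]
    exact MeasurableSet.iInter fun l => measurableSet_lt (by fun_prop) (by fun_prop)
  have e1 : {x : Fin (N + 3) → S | IsFar r x i} = MeasurableEquiv.piFinSuccAbove (fun _ => S) i ⁻¹'
      {q : S × (Fin (N + 2) → S) | ∀ l, r < dist q.1 (q.2 l)} := by
    ext x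
    change IsFar r x i ↔ ∀ l, r < dist (x i) (x (i.succAbove l))
    rw [IsFar, Fin.forall_iff_succAbove i]
    simp [Fin.succAbove_ne]
  rw [e1, (measurePreserving_piFinSuccAbove (fun _ => μ) i).measure_preimage_equiv,
    Measure.prod_apply hm]
  refine lintegral_congr fun a => ?_
  have : Prod.mk a ⁻¹' {q : S × (Fin (N + 2) → S) | ∀ l, r < dist q.1 (q.2 l)} =
      Set.univ.pi fun _ => (closedBall a r)ᶜ := by
    ext y; simp [dist_comm]
  rw [this, Measure.pi_pi]
  simp

lemma ae_injective (hμ : ∀ᵐ x ∂μ, μ {x} = 0) (N : ℕ) :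
    ∀ᵐ x ∂(Measure.pi fun _ : Fin (N + 1) => μ), Function.Injective x := by
  have key : ∀ i : Fin (N + 1), ∀ᵐ x ∂(Measure.pi fun _ : Fin (N + 1) => μ),
      ∀ l, x (i.succAbove l) ≠ x i := by
    intro i
    have hm : MeasurableSet {q : S × (Fin N → S) | ∀ l, q.2 l ≠ q.1} := by
      have : {q : S × (Fin N → S) | ∀ l, q.2 l ≠ q.1} = ⋂ l, {q | q.2 l = q.1}ᶜ := by
        ext q; simp
      rw [this]
      exact MeasurableSet.iInter fun l =>
        (measurableSet_eq_fun (by fun_prop) (by fun_prop)).compl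
    have hp : ∀ᵐ q ∂(μ.prod (Measure.pi fun _ : Fin N => μ)), ∀ l, q.2 l ≠ q.1 := by
      rw [ae_iff, ← Set.compl_ofPred, Measure.measure_prod_null hm.compl]
      filter_upwards [hμ] with x hx
      exact ae_iff.1 (ae_ne_of_measure_singleton hx N)
    exact (measurePreserving_piFinSuccAbove (fun _ => μ) i).quasiMeasurePreserving.ae hp
  filter_upwards [ae_all_iff.2 key] with x hx i j hij
  by_contra hne
  obtain ⟨l, hl⟩ := Fin.exists_succAbove_eq (Ne.symm hne)
  exact hx i l (by rw [hl, hij])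

end Count

/-! ### The limit theorem in a metric space -/

section Assembly

variable {S : Type*} [MetricSpace S] [MeasurableSpace S] [BorelSpace S]
  [SecondCountableTopology S] {μ : Measure S}

lemma LocalModel.measure_singleton {F : Type*} [NormedAddCommGroup F] [NormedSpace ℝ F]
    [FiniteDimensional ℝ F] [Nontrivial F] [MeasureSpace F] [BorelSpace F]
    [(volume : Measure F).IsAddHaarMeasure] {x : S} (M : LocalModel F μ x) : μ {x} = 0 := by
  have h1 : μ {x} = μ.restrict (closedBall x M.radius) {x} := by
    rw [Measure.restrict_apply (measurableSet_singleton x), Set.inter_eq_left.2]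
    simpa using M.radius_pos.le
  have hd := M.measurable_dens
  rw [h1, M.restrict_eq, Measure.map_apply M.measurable_param (measurableSet_singleton x),
    withDensity_apply _ (M.measurable_param (measurableSet_singleton x)), setLIntegral_eq_zero_iff
      (M.measurable_param (measurableSet_singleton x)) (by fun_prop)]
  have : ∀ᵐ u : F, u ≠ M.center := by
    rw [ae_iff]; simp
  filter_upwards [this] with u hu hux
  by_contra h
  have h2 := M.norm_le u fun h0 => h (by simp [h0])
  rw [show M.param u = x from hux, dist_self, mul_zero] at h2
  exact hu (sub_eq_zero.1 (norm_le_zero_iff.1 h2))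

variable [IsProbabilityMeasure μ] {m : ℕ} [Nontrivial (EuclideanSpace ℝ (Fin m))]
  {K : ℕ} {rel : ℝ → ℝ → Prop}

/-- The limit of the expected number of pairs with the nearest neighbour `x` at distance at most
`R`, at the scale of the nearest neighbour distances. A lower limit makes sense, and is measurable,
without any assumption on `x`. -/
noncomputable def limPairCount (m : ℕ) (μ : Measure S) (R : ℕ) (x : S) : ℝ≥0∞ :=
  liminf (fun N => meanPairCount μ (fun a b => a < b) (R * nnScale m N) N x) atTop

/-- The limit of the probability that the nearest neighbour of `x` is at distance more than `R`, at
the scale of the nearest neighbour distances. It is a lower limit for the same reason as in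
`limPairCount`. -/
noncomputable def limFar (m : ℕ) (μ : Measure S) (R : ℕ) (x : S) : ℝ≥0∞ :=
  liminf (fun N => μ (closedBall x (R * nnScale m N))ᶜ ^ (N + 2)) atTop

lemma measurable_limPairCount (R : ℕ) : Measurable (limPairCount m μ R) :=
  Measurable.liminf fun N => measurable_meanPairCount isComparison_lt _ N

lemma measurable_measure_compl_closedBall_pow (r : ℝ) (N : ℕ) :
    Measurable fun x => μ (closedBall x r)ᶜ ^ (N + 2) := by
  have h : MeasurableSet {q : S × S | dist q.2 q.1 ≤ r} :=
    measurableSet_le (by fun_prop) (by fun_prop)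
  exact (measurable_measure_prodMk_left h.compl).pow_const _

lemma measurable_limFar (R : ℕ) : Measurable (limFar m μ R) :=
  Measurable.liminf fun N => measurable_measure_compl_closedBall_pow _ N

lemma LocalModel.tendsto_meanPairCount {x : S} (M : LocalModel (EuclideanSpace ℝ (Fin m)) μ x)
    (hrel : IsComparison rel) (R : ℕ) :
    Tendsto (fun N => meanPairCount μ rel (R * nnScale m N) N x) atTop
      (𝓝 (limPairCount m μ R x)) := by
  have h1 := M.tendsto_lintegral_pairWeight hrel R
  have h2 := M.tendsto_lintegral_pairWeight isComparison_lt R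
  simp only [← meanPairCount_eq hrel, ← meanPairCount_eq isComparison_lt,
    finrank_euclideanSpace_fin] at h1 h2
  rw [limPairCount, h2.liminf_eq]
  exact h1

lemma LocalModel.tendsto_limPairCount {x : S} (M : LocalModel (EuclideanSpace ℝ (Fin m)) μ x) :
    Tendsto (fun R => limPairCount m μ R x) atTop (𝓝 (tripleLConst m)) := by
  refine (tendsto_lintegral_pairLimit M.lin M.val_pos).congr fun R => ?_
  have h2 := M.tendsto_lintegral_pairWeight isComparison_lt R
  simp only [← meanPairCount_eq isComparison_lt, finrank_euclideanSpace_fin] at h2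
  exact tendsto_nhds_unique h2 (M.tendsto_meanPairCount isComparison_lt R)

lemma LocalModel.tendsto_far {x : S} (M : LocalModel (EuclideanSpace ℝ (Fin m)) μ x) (R : ℕ) :
    Tendsto (fun N => μ (closedBall x (R * nnScale m N))ᶜ ^ (N + 2)) atTop
      (𝓝 (limFar m μ R x)) := by
  have h := M.tendsto_measure_compl_closedBall_pow R
  simp only [finrank_euclideanSpace_fin] at h
  rw [limFar, h.liminf_eq]
  exact h

lemma LocalModel.tendsto_limFar {x : S} (M : LocalModel (EuclideanSpace ℝ (Fin m)) μ x) :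
    Tendsto (fun R => limFar m μ R x) atTop (𝓝 0) := by
  refine (tendsto_exp_neg_volume M.lin M.val_pos).congr fun R => ?_
  have h := M.tendsto_measure_compl_closedBall_pow R
  simp only [finrank_euclideanSpace_fin] at h
  exact tendsto_nhds_unique h (M.tendsto_far R)

section Limits

variable (hK : HasKissingBound S K)
  (hreg : ∀ᵐ x ∂μ, Nonempty (LocalModel (EuclideanSpace ℝ (Fin m)) μ x))

include hreg

lemma ae_measure_singleton_of_localModel : ∀ᵐ x ∂μ, μ {x} = 0 :=
  hreg.mono fun _ hx => hx.elim fun M => M.measure_singleton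

lemma tendsto_lintegral_far (R : ℕ) :
    Tendsto (fun N => ∫⁻ x, μ (closedBall x (R * nnScale m N))ᶜ ^ (N + 2) ∂μ) atTop
      (𝓝 (∫⁻ x, limFar m μ R x ∂μ)) := by
  refine tendsto_lintegral_of_dominated_convergence (fun _ => 1)
    (fun N => measurable_measure_compl_closedBall_pow _ N)
    (fun N => ae_of_all _ fun x => pow_le_one₀ zero_le prob_le_one) (by simp) ?_
  exact hreg.mono fun x hx => hx.elim fun M => M.tendsto_far R

lemma tendsto_lintegral_limFar :
    Tendsto (fun R => ∫⁻ x, limFar m μ R x ∂μ) atTop (𝓝 0) := by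
  have := tendsto_lintegral_of_dominated_convergence (μ := μ) (F := limFar m μ) (f := fun _ => 0)
    (fun _ => 1) measurable_limFar (fun R => ?_) (by simp)
    (hreg.mono fun x hx => hx.elim fun M => M.tendsto_limFar)
  · simpa using this
  · filter_upwards [hreg] with x ⟨M⟩
    exact le_of_tendsto' (M.tendsto_far R) fun N => pow_le_one₀ zero_le prob_le_one

include hK

lemma tendsto_lintegral_meanPairCount (hrel : IsComparison rel) (R : ℕ) :
    Tendsto (fun N => ∫⁻ x, meanPairCount μ rel (R * nnScale m N) N x ∂μ) atTop
      (𝓝 (∫⁻ x, limPairCount m μ R x ∂μ)) := by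
  refine tendsto_lintegral_of_dominated_convergence (fun _ => (K : ℝ≥0∞) * K)
    (fun N => measurable_meanPairCount hrel _ N) (fun N => ?_)
    (by simpa using ENNReal.mul_ne_top (ENNReal.natCast_ne_top K) (ENNReal.natCast_ne_top K)) ?_
  · filter_upwards [ae_measure_singleton_of_localModel hreg] with x hx
    exact meanPairCount_le hrel hK _ N hx
  · exact hreg.mono fun x hx => hx.elim fun M => M.tendsto_meanPairCount hrel R

lemma ae_limPairCount_le (R : ℕ) : ∀ᵐ x ∂μ, limPairCount m μ R x ≤ (K : ℝ≥0∞) * K := by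
  filter_upwards [hreg] with x ⟨M⟩
  exact le_of_tendsto' (M.tendsto_meanPairCount isComparison_lt R) fun N =>
    meanPairCount_le isComparison_lt hK _ N M.measure_singleton

lemma tendsto_lintegral_limPairCount :
    Tendsto (fun R => ∫⁻ x, limPairCount m μ R x ∂μ) atTop (𝓝 (tripleLConst m)) := by
  have := tendsto_lintegral_of_dominated_convergence (μ := μ) (F := limPairCount m μ)
    (f := fun _ => tripleLConst m) (fun _ => (K : ℝ≥0∞) * K) measurable_limPairCount
    (fun R => ae_limPairCount_le hK hreg R)
    (by simpa using ENNReal.mul_ne_top (ENNReal.natCast_ne_top K) (ENNReal.natCast_ne_top K))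
    (hreg.mono fun x hx => hx.elim fun M => M.tendsto_limPairCount)
  simpa using this

/-- Finiteness of `𝔬_m` comes for free: it is a limit of mean numbers of pairs of points with the
same nearest neighbour, which the kissing bound controls. -/
lemma tripleLConst_lt_top : tripleLConst m < ⊤ := by
  have h : tripleLConst m ≤ (K : ℝ≥0∞) * K := by
    refine le_of_tendsto' (tendsto_lintegral_limPairCount hK hreg) fun R => ?_
    calc _ ≤ ∫⁻ _, (K : ℝ≥0∞) * K ∂μ := lintegral_mono_ae (ae_limPairCount_le hK hreg R)
      _ = _ := by simp
  exact h.trans_lt (ENNReal.mul_lt_top (ENNReal.natCast_lt_top K) (ENNReal.natCast_lt_top K))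

end Limits

lemma measurable_pairCount_removeNth {n : ℕ} (hrel : IsComparison rel) (r : ℝ) (k : Fin (n + 1)) :
    Measurable fun x : Fin (n + 1) → S => pairCount rel r (x k) (k.removeNth x) := by
  have h : Measurable fun x : Fin (n + 1) → S => (x k, k.removeNth x) :=
    (measurable_pi_apply k).prodMk (measurable_pi_lambda _ fun i => measurable_pi_apply _)
  have h2 : Measurable fun q : S × (Fin n → S) => pairCount rel r q.1 q.2 :=
    measurable_pairCount hrel r
  fun_prop

section Sample

variable {Ω : Type*} [MeasurableSpace Ω] {P : Measure Ω} [IsProbabilityMeasure P]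
  {X : ℕ → Ω → S}

/-- The law of the first `n` points. -/
lemma map_sample_eq_pi (hX : ∀ i, Measurable (X i)) (hindep : iIndepFun X P)
    (hlaw : ∀ i, Measure.map (X i) P = μ) (n : ℕ) :
    Measure.map (fun s (i : Fin n) => X i s) P = Measure.pi fun _ => μ := by
  have h := hindep.precomp (g := fun i : Fin n => (i : ℕ)) Fin.val_injective
  have h2 := (iIndepFun_iff_map_fun_eq_pi_map fun i : Fin n => (hX i).aemeasurable).1 h
  simpa only [hlaw] using h2

variable (hX : ∀ i, Measurable (X i)) (hindep : iIndepFun X P)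
  (hlaw : ∀ i, Measure.map (X i) P = μ) {N : ℕ} {T : Ω → Fin (N + 3) → Fin (N + 3)}
  (hT : ∀ s i, IsNearestNeighbor (fun l : Fin (N + 3) => X l s) i (T s i))

include hX hindep hlaw hT

lemma le_lintegral_numTriples (r : ℝ) :
    ((N : ℝ≥0∞) + 3) * ∫⁻ x, meanPairCount μ (fun a b => a < b) r N x ∂μ ≤
      ∫⁻ s, numTriples (T s) ∂P := by
  have hmap := map_sample_eq_pi hX hindep hlaw (N + 3)
  have hmk := fun k : Fin (N + 3) =>
    measurable_pairCount_removeNth (S := S) isComparison_lt r k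
  calc _ = ∫⁻ x, ∑ k : Fin (N + 3), pairCount (fun a b => a < b) r (x k) (k.removeNth x)
        ∂(Measure.pi fun _ : Fin (N + 3) => μ) := by
        rw [lintegral_finsetSum _ fun k _ => hmk k]
        simp [lintegral_pairCount_removeNth isComparison_lt]
    _ = ∫⁻ s, ∑ k : Fin (N + 3), pairCount (fun a b => a < b) r (X k s)
        (k.removeNth fun i : Fin (N + 3) => X i s) ∂P := by
        have h := lintegral_map (μ := P) (Finset.measurable_sum Finset.univ fun k _ => hmk k)
          (measurable_pi_lambda (fun s (i : Fin (N + 3)) => X i s) fun i => hX i)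
        rw [hmap] at h
        exact h
    _ ≤ _ := lintegral_mono fun s => sum_pairCount_le_numTriples (hT s) r

lemma lintegral_numTriples_le (hK : HasKissingBound S K) (hμ : ∀ᵐ x ∂μ, μ {x} = 0) (r : ℝ) :
    ∫⁻ s, numTriples (T s) ∂P ≤
      ((N : ℝ≥0∞) + 3) * (∫⁻ x, meanPairCount μ (fun a b => a ≤ b) r N x ∂μ +
        2 * K * ∫⁻ x, μ (closedBall x r)ᶜ ^ (N + 2) ∂μ) := by
  classical
  have hmap := map_sample_eq_pi hX hindep hlaw (N + 3)
  have hmX : Measurable fun s (i : Fin (N + 3)) => X i s := measurable_pi_lambda _ fun i => hX i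
  have hmk := fun k : Fin (N + 3) =>
    measurable_pairCount_removeNth (S := S) isComparison_le r k
  have hmf : ∀ i : Fin (N + 3), Measurable fun x : Fin (N + 3) → S =>
      if IsFar r x i then (1 : ℝ≥0∞) else 0 := fun i =>
    Measurable.ite (measurableSet_isFar r i) measurable_const measurable_const
  have hm1 : Measurable fun x : Fin (N + 3) → S =>
      ∑ k : Fin (N + 3), pairCount (fun a b => a ≤ b) r (x k) (k.removeNth x) :=
    Finset.measurable_sum _ fun k _ => hmk k
  have hm2 : Measurable fun x : Fin (N + 3) → S =>
      ∑ i : Fin (N + 3), if IsFar r x i then (1 : ℝ≥0∞) else 0 :=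
    Finset.measurable_sum _ fun k _ => hmf k
  have hinj : ∀ᵐ s ∂P, Function.Injective fun i : Fin (N + 3) => X i s := by
    have := ae_injective hμ (N + 2)
    rw [← hmap] at this
    exact ae_of_ae_map hmX.aemeasurable this
  have hfar : ∀ i : Fin (N + 3), ∫⁻ x, (if IsFar r x i then (1 : ℝ≥0∞) else 0)
      ∂(Measure.pi fun _ : Fin (N + 3) => μ) = ∫⁻ x, μ (closedBall x r)ᶜ ^ (N + 2) ∂μ := by
    intro i
    have : (fun x : Fin (N + 3) → S => if IsFar r x i then (1 : ℝ≥0∞) else 0) =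
        {x | IsFar r x i}.indicator 1 := by
      ext x; simp [Set.indicator_apply]
    rw [this, lintegral_indicator_one (measurableSet_isFar r i), measure_isFar]
  calc _ ≤ ∫⁻ s, (∑ k : Fin (N + 3), pairCount (fun a b => a ≤ b) r (X k s)
          (k.removeNth fun i : Fin (N + 3) => X i s) +
          2 * K * ∑ i : Fin (N + 3), if IsFar r (fun l : Fin (N + 3) => X l s) i
            then 1 else 0) ∂P := by
        refine lintegral_mono_ae ?_
        filter_upwards [hinj] with s hs
        exact numTriples_le hK hs (hT s) r
    _ = ∫⁻ x, (∑ k : Fin (N + 3), pairCount (fun a b => a ≤ b) r (x k) (k.removeNth x) +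
          2 * K * ∑ i : Fin (N + 3), if IsFar r x i then 1 else 0)
          ∂(Measure.pi fun _ : Fin (N + 3) => μ) := by
        have h := lintegral_map (μ := P) (hm1.add (hm2.const_mul (2 * K))) hmX
        rw [hmap] at h
        exact h.symm
    _ = _ := by
        rw [lintegral_add_left hm1, lintegral_const_mul _ hm2,
          lintegral_finsetSum _ fun k _ => hmk k, lintegral_finsetSum _ fun k _ => hmf k]
        simp only [lintegral_pairCount_removeNth isComparison_le, hfar, Finset.sum_const,
          Finset.card_univ, Fintype.card_fin, nsmul_eq_mul]
        push_cast
        ring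

end Sample

/-- The limit of the expected number of triples, for a law with local models in a metric space
with bounded kissing numbers. -/
lemma tendsto_lintegral_numTriples (hK : HasKissingBound S K)
    (hreg : ∀ᵐ x ∂μ, Nonempty (LocalModel (EuclideanSpace ℝ (Fin m)) μ x))
    {Ω : Type*} [MeasurableSpace Ω] {P : Measure Ω} [IsProbabilityMeasure P] {X : ℕ → Ω → S}
    (hX : ∀ i, Measurable (X i)) (hindep : iIndepFun X P) (hlaw : ∀ i, Measure.map (X i) P = μ)
    {T : (N : ℕ) → Ω → Fin (N + 3) → Fin (N + 3)}
    (hT : ∀ N s i, IsNearestNeighbor (fun l : Fin (N + 3) => X l s) i (T N s i)) :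
    Tendsto (fun N : ℕ => ((N : ℝ≥0∞) + 3)⁻¹ * ∫⁻ s, numTriples (T N s) ∂P) atTop
      (𝓝 (tripleLConst m)) := by
  have hμ := ae_measure_singleton_of_localModel hreg
  have hlow : ∀ R N : ℕ, ∫⁻ x, meanPairCount μ (fun a b => a < b) (R * nnScale m N) N x ∂μ ≤
      ((N : ℝ≥0∞) + 3)⁻¹ * ∫⁻ s, numTriples (T N s) ∂P := by
    intro R N
    rw [← ENNReal.mul_le_iff_le_inv (by simp) (by finiteness)]
    exact le_lintegral_numTriples hX hindep hlaw (hT N) _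
  have hupp : ∀ R N : ℕ, ((N : ℝ≥0∞) + 3)⁻¹ * ∫⁻ s, numTriples (T N s) ∂P ≤
      ∫⁻ x, meanPairCount μ (fun a b => a ≤ b) (R * nnScale m N) N x ∂μ +
        2 * K * ∫⁻ x, μ (closedBall x (R * nnScale m N))ᶜ ^ (N + 2) ∂μ := by
    intro R N
    rw [ENNReal.inv_mul_le_iff (by simp) (by finiteness)]
    exact lintegral_numTriples_le hX hindep hlaw (hT N) hK hμ _
  refine tendsto_of_le_liminf_of_limsup_le ?_ ?_
  · refine le_of_tendsto' (tendsto_lintegral_limPairCount hK hreg) fun R => ?_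
    rw [← (tendsto_lintegral_meanPairCount hK hreg isComparison_lt R).liminf_eq]
    exact liminf_le_liminf (Eventually.of_forall (hlow R))
  · have h2K : (2 * K : ℝ≥0∞) ≠ ⊤ := by finiteness
    have hlim : Tendsto (fun R => ∫⁻ x, limPairCount m μ R x ∂μ +
        2 * K * ∫⁻ x, limFar m μ R x ∂μ) atTop (𝓝 (tripleLConst m)) := by
      simpa using (tendsto_lintegral_limPairCount hK hreg).add
        (ENNReal.Tendsto.const_mul (tendsto_lintegral_limFar hreg) (Or.inr h2K))
    refine ge_of_tendsto' hlim fun R => ?_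
    rw [← ((tendsto_lintegral_meanPairCount hK hreg isComparison_le R).add
      (ENNReal.Tendsto.const_mul (tendsto_lintegral_far hreg R) (Or.inr h2K))).limsup_eq]
    exact limsup_le_limsup (Eventually.of_forall (hupp R))

end Assembly

/-! ### The kissing bound in Euclidean space -/

section Kissing

variable {E : Type*} [NormedAddCommGroup E] [InnerProductSpace ℝ E]

/-- If the side `v - w` of a triangle with a vertex at the origin is the longest, then the angle
at the origin is at least 60 degrees. -/
lemma one_le_norm_sub_normalize {v w : E} (hv : v ≠ 0) (hw : w ≠ 0) (h1 : ‖v‖ ≤ ‖v - w‖)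
    (h2 : ‖w‖ ≤ ‖v - w‖) : 1 ≤ ‖‖v‖⁻¹ • v - ‖w‖⁻¹ • w‖ := by
  have hv' := norm_pos_iff.2 hv
  have hw' := norm_pos_iff.2 hw
  have h3 := norm_sub_sq_real v w
  have h1' : ‖v‖ ^ 2 ≤ ‖v - w‖ ^ 2 := by gcongr
  have h2' : ‖w‖ ^ 2 ≤ ‖v - w‖ ^ 2 := by gcongr
  have h4 : 2 * inner ℝ v w ≤ ‖v‖ * ‖w‖ := by
    rcases le_total ‖v‖ ‖w‖ with h | h
    · nlinarith
    · nlinarith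
  have h5 := norm_sub_sq_real (‖v‖⁻¹ • v) (‖w‖⁻¹ • w)
  rw [inner_smul_left, inner_smul_right, norm_smul, norm_smul, norm_inv, norm_inv, norm_norm,
    norm_norm, inv_mul_cancel₀ hv'.ne', inv_mul_cancel₀ hw'.ne'] at h5
  have h6 : 2 * (‖v‖⁻¹ * (‖w‖⁻¹ * inner ℝ v w)) ≤ 1 := by
    rw [show 2 * (‖v‖⁻¹ * (‖w‖⁻¹ * inner ℝ v w)) = (‖v‖ * ‖w‖)⁻¹ * (2 * inner ℝ v w) by
      rw [mul_inv]; ring, inv_mul_le_iff₀ (by positivity)]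
    linarith
  simp only [RCLike.conj_to_real] at h5
  have h7 : 1 ≤ ‖‖v‖⁻¹ • v - ‖w‖⁻¹ • w‖ ^ 2 := by rw [h5]; linarith
  exact (one_le_sq_iff₀ (norm_nonneg _)).1 h7

/-- Directions from a point to the points of which it is a nearest neighbour form angles of at least
60 degrees, and the unit sphere is compact. -/
lemma exists_hasKissingBound [FiniteDimensional ℝ E] (s : Set E) : ∃ K, HasKissingBound s K := by
  obtain ⟨t, -, htf, ht⟩ := (isCompact_sphere (0 : E) 1).finite_cover_balls (e := 1 / 2)
    (by norm_num)
  refine ⟨htf.toFinset.card, fun x n y q hne hq => ?_⟩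
  have hvne : ∀ i ∈ q, (y i : E) - x ≠ 0 := fun i hi h =>
    hne i hi (Subtype.ext (sub_eq_zero.1 h))
  have hcov : ∀ i, ∃ c, i ∈ q → c ∈ t ∧
      dist (‖(y i : E) - x‖⁻¹ • ((y i : E) - x)) c < 1 / 2 := by
    intro i
    by_cases hi : i ∈ q
    · have : ‖(y i : E) - x‖⁻¹ • ((y i : E) - x) ∈ sphere (0 : E) 1 := by
        rw [mem_sphere_zero_iff_norm, norm_smul, norm_inv, norm_norm,
          inv_mul_cancel₀ (norm_pos_iff.2 (hvne i hi)).ne']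
      obtain ⟨c, hc, hc2⟩ := Set.mem_iUnion₂.1 (ht this)
      exact ⟨c, fun _ => ⟨hc, hc2⟩⟩
    · exact ⟨0, fun h => absurd h hi⟩
  choose c hc using hcov
  -- Unit vectors at distance at least `1` cannot lie in the same ball of radius `1 / 2`.
  refine Finset.card_le_card_of_injOn c (fun i hi => htf.mem_toFinset.2 (hc i hi).1) ?_
  intro i hi j hj hij
  by_contra hne'
  have h1 := hq i hi j hj hne'
  have h2 := hq j hj i hi (Ne.symm hne')
  rw [Subtype.dist_eq, Subtype.dist_eq, dist_eq_norm, dist_eq_norm] at h1 h2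
  have h3 : (y i : E) - y j = (y i - x) - (y j - x) := by abel
  rw [h3] at h1
  rw [norm_sub_rev (y j : E) (y i), h3] at h2
  have h4 := one_le_norm_sub_normalize (hvne i hi) (hvne j hj) h1 h2
  have h5 := dist_triangle_right (‖(y i : E) - x‖⁻¹ • ((y i : E) - x))
    (‖(y j : E) - x‖⁻¹ • ((y j : E) - x)) (c i)
  have h6 := (hc j hj).2
  rw [← hij] at h6
  rw [dist_eq_norm (‖(y i : E) - x‖⁻¹ • ((y i : E) - x))] at h5
  linarith [(hc i hi).2]

end Kissing

/-! ### Local models from charts -/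

section Charts

/-- The norm that an injective linear map pulls back from `E` is induced by an automorphism. -/
lemma exists_continuousLinearEquiv_norm_eq {m : ℕ} {E : Type*} [NormedAddCommGroup E]
    [InnerProductSpace ℝ E] (L : EuclideanSpace ℝ (Fin m) →L[ℝ] E) (hL : Function.Injective L) :
    ∃ T : EuclideanSpace ℝ (Fin m) ≃L[ℝ] EuclideanSpace ℝ (Fin m), ∀ u, ‖T u‖ = ‖L u‖ := by
  set L' : EuclideanSpace ℝ (Fin m) →ₗ[ℝ] E := L.toLinearMap
  have hr : finrank ℝ (LinearMap.range L') = m := by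
    rw [LinearMap.finrank_range_of_inj hL, finrank_euclideanSpace_fin]
  set b := (stdOrthonormalBasis ℝ (LinearMap.range L')).reindex (finCongr hr)
  refine ⟨((LinearEquiv.ofInjective L' hL).trans b.repr.toLinearEquiv).toContinuousLinearEquiv,
    fun u => ?_⟩
  change ‖b.repr (LinearEquiv.ofInjective L' hL u)‖ = ‖L u‖
  rw [LinearIsometryEquiv.norm_map]
  rfl

lemma HasFDerivAt.tendsto_dist_div {F E : Type*} [NormedAddCommGroup F] [NormedSpace ℝ F]
    [NormedAddCommGroup E] [NormedSpace ℝ E] {f : F → E} {L : F →L[ℝ] E} {a : F}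
    (hf : HasFDerivAt f L a) (u w : F) :
    Tendsto (fun ε : ℝ => dist (f (a + ε • u)) (f (a + ε • w)) / ε) (𝓝[>] 0)
      (𝓝 ‖L u - L w‖) := by
  have h : ∀ u, Tendsto (fun ε : ℝ => ε⁻¹ • (f (a + ε • u) - f a)) (𝓝[>] 0) (𝓝 (L u)) := by
    intro u
    have := (hf.hasLineDerivAt u).tendsto_slope_zero_right
    simpa using this
  refine ((h u).sub (h w)).norm.congr' ?_
  filter_upwards [self_mem_nhdsWithin] with ε (hε : 0 < ε)
  rw [← smul_sub, norm_smul, norm_inv, Real.norm_of_nonneg hε.le, sub_sub_sub_cancel_right,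
    dist_eq_norm, inv_mul_eq_div]

lemma HasFDerivAt.exists_eventually_norm_sub_le {F E : Type*} [NormedAddCommGroup F]
    [NormedSpace ℝ F] [FiniteDimensional ℝ F] [NormedAddCommGroup E] [NormedSpace ℝ E] {f : F → E}
    {L : F →L[ℝ] E} {a : F} (hf : HasFDerivAt f L a) (hL : Function.Injective L) :
    ∃ C : ℝ, 0 < C ∧ ∀ᶠ u in 𝓝 a, ‖u - a‖ ≤ C * dist (f u) (f a) := by
  obtain ⟨k, hk0, hk⟩ := LinearMap.exists_antilipschitzWith (L : F →ₗ[ℝ] E)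
    (LinearMap.ker_eq_bot.2 hL)
  have hk0' : (0 : ℝ) < k := hk0
  refine ⟨2 * k, by positivity, ?_⟩
  filter_upwards [hf.isLittleO.def (c := (2 * (k : ℝ))⁻¹) (by positivity)] with u hu
  have h1 : ‖u - a‖ ≤ k * ‖L (u - a)‖ := by
    simpa [dist_eq_norm] using hk.le_mul_dist (u - a) 0
  have h2 : ‖L (u - a)‖ ≤ ‖f u - f a‖ + (2 * (k : ℝ))⁻¹ * ‖u - a‖ := by
    have := norm_sub_norm_le (L (u - a)) (f u - f a)
    rw [norm_sub_rev (L (u - a))] at this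
    linarith
  have h3 : k * ‖L (u - a)‖ ≤ k * ‖f u - f a‖ + ‖u - a‖ / 2 :=
    calc _ ≤ k * (‖f u - f a‖ + (2 * (k : ℝ))⁻¹ * ‖u - a‖) := by gcongr
      _ = _ := by field_simp
  rw [dist_eq_norm]
  linarith

/-- The Lebesgue differentiation theorem, in rescaled balls. -/
lemma ae_tendsto_lintegral_edist_rescaled {F : Type*} [NormedAddCommGroup F] [NormedSpace ℝ F]
    [FiniteDimensional ℝ F] [Nontrivial F] [MeasureSpace F] [BorelSpace F]
    [(volume : Measure F).IsAddHaarMeasure] {g : F → ℝ≥0} (hg : Measurable g)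
    (hfin : ∫⁻ u, g u ≠ ⊤) :
    ∀ᵐ a : F, ∀ ρ : ℝ, Tendsto (fun ε : ℝ => ∫⁻ u in closedBall 0 ρ, edist (g (a + ε • u)) (g a))
      (𝓝[>] 0) (𝓝 0) := by
  have hint : Integrable (fun u => (g u : ℝ)) := by
    refine ⟨(by fun_prop : Measurable fun u => (g u : ℝ)).aestronglyMeasurable, ?_⟩
    rw [HasFiniteIntegral]
    simpa [lt_top_iff_ne_top] using hfin
  have hae := (Besicovitch.vitaliFamily (volume : Measure F)).ae_tendsto_lintegral_enorm_sub_div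
    hint.locallyIntegrable
  filter_upwards [hae] with a ha
  have hpos : ∀ ρ : ℝ, 0 < ρ → Tendsto (fun ε : ℝ =>
      ∫⁻ u in closedBall 0 ρ, edist (g (a + ε • u)) (g a)) (𝓝[>] 0) (𝓝 0) := by
    intro ρ hρ
    have hlim : Tendsto (fun ε : ℝ => ε * ρ) (𝓝[>] 0) (𝓝[>] 0) := by
      refine tendsto_nhdsWithin_iff.2 ⟨?_, ?_⟩
      · have : Tendsto (fun ε : ℝ => ε * ρ) (𝓝 0) (𝓝 (0 * ρ)) := tendsto_id.mul_const ρ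
        rw [zero_mul] at this
        exact this.mono_left nhdsWithin_le_nhds
      · filter_upwards [self_mem_nhdsWithin] with ε (hε : 0 < ε)
        exact mul_pos hε hρ
    have h1 := (ha.comp (Besicovitch.tendsto_filterAt volume a)).comp hlim
    have hbt : volume (closedBall (0 : F) ρ) ≠ ⊤ := measure_closedBall_lt_top.ne
    have h2 := ENNReal.Tendsto.const_mul h1 (Or.inr hbt)
    rw [mul_zero] at h2
    refine h2.congr' ?_
    filter_upwards [self_mem_nhdsWithin] with ε (hε : 0 < ε)
    have hb0 : volume (closedBall (0 : F) ρ) ≠ 0 := (measure_closedBall_pos volume 0 hρ).ne'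
    have hε0 : ENNReal.ofReal (ε ^ finrank ℝ F) ≠ 0 := by
      rw [Ne, ENNReal.ofReal_eq_zero, not_le]; positivity
    have hed : ∀ u : F, ‖(g u : ℝ) - g a‖ₑ = edist (g u) (g a) := fun u =>
      (edist_eq_enorm_sub _ _).symm
    have hmeas : Measurable fun u => edist (g u) (g a) := hg.edist measurable_const
    simp only [Function.comp_apply, hed]
    have hind : ∫⁻ u in closedBall a (ε * ρ), edist (g u) (g a) = ENNReal.ofReal
        (ε ^ finrank ℝ F) * ∫⁻ u in closedBall 0 ρ, edist (g (a + ε • u)) (g a) := by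
      rw [← lintegral_indicator measurableSet_closedBall,
        lintegral_eq_ofReal_pow_mul_lintegral_add_smul a hε
          (hmeas.indicator measurableSet_closedBall),
        ← lintegral_indicator measurableSet_closedBall]
      congr 1
      refine lintegral_congr fun u => ?_
      have : a + ε • u ∈ closedBall a (ε * ρ) ↔ u ∈ closedBall (0 : F) ρ := by
        rw [mem_closedBall_iff_norm, add_sub_cancel_left, norm_smul, Real.norm_of_nonneg hε.le,
          mem_closedBall_zero_iff, mul_le_mul_iff_right₀ hε]
      by_cases h : u ∈ closedBall (0 : F) ρ
      · rw [Set.indicator_of_mem h, Set.indicator_of_mem (this.2 h)]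
      · rw [Set.indicator_of_notMem h, Set.indicator_of_notMem (mt this.1 h)]
    rw [hind, Measure.addHaar_closedBall_mul _ _ hε.le hρ.le,
      ENNReal.mul_div_mul_left _ _ hε0 ENNReal.ofReal_ne_top, ENNReal.mul_div_cancel hb0 hbt]
  intro ρ
  refine tendsto_of_tendsto_of_tendsto_of_le_of_le tendsto_const_nhds
    (hpos (max ρ 1) (by positivity)) (fun _ => zero_le) fun ε => ?_
  exact lintegral_mono_set (closedBall_subset_closedBall (le_max_left _ _))

variable {S : Type*} [MetricSpace S] [MeasurableSpace S] [BorelSpace S]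
  {μ : Measure S} [IsFiniteMeasure μ] {m : ℕ}
  {E : Type*} [NormedAddCommGroup E] [InnerProductSpace ℝ E]

/-- A chart in which the law has a density, with a Lebesgue point where the density is positive and
where the inverse of the chart has an injective derivative, yields a local model. -/
lemma nonempty_localModel_of_chart {j : S → E} (hj : Isometry j)
    (ψ : OpenPartialHomeomorph S (EuclideanSpace ℝ (Fin m)))
    {g : EuclideanSpace ℝ (Fin m) → ℝ≥0} (hg : Measurable g)
    (hlaw : Measure.map ψ (μ.restrict ψ.source) = volume.withDensity fun u => (g u : ℝ≥0∞))
    {a : EuclideanSpace ℝ (Fin m)} (ha : a ∈ ψ.target) (hpos : 0 < g a)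
    {L : EuclideanSpace ℝ (Fin m) →L[ℝ] E} (hL : Function.Injective L)
    (hder : HasFDerivAt (j ∘ ψ.symm) L a)
    (hleb : ∀ ρ : ℝ, Tendsto (fun ε : ℝ => ∫⁻ u in closedBall 0 ρ, edist (g (a + ε • u)) (g a))
      (𝓝[>] 0) (𝓝 0)) :
    Nonempty (LocalModel (EuclideanSpace ℝ (Fin m)) μ (ψ.symm a)) := by
  classical
  set x := ψ.symm a with hx
  have hxs : x ∈ ψ.source := ψ.map_target ha
  obtain ⟨T, hT⟩ := exists_continuousLinearEquiv_norm_eq L hL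
  obtain ⟨C, hC, hCev⟩ := hder.exists_eventually_norm_sub_le hL
  have hU : ψ.source ∩ ψ ⁻¹' {u | ‖u - a‖ ≤ C * dist ((j ∘ ψ.symm) u) ((j ∘ ψ.symm) a)} ∈ 𝓝 x := by
    refine inter_mem (ψ.open_source.mem_nhds hxs) ((ψ.continuousAt hxs).preimage_mem_nhds ?_)
    rw [hx, ψ.right_inv ha]
    exact hCev
  obtain ⟨δ, hδ, hδU⟩ := nhds_basis_closedBall.mem_iff.1 hU
  set φ : EuclideanSpace ℝ (Fin m) → S := ψ.target.piecewise ψ.symm fun _ => x with hφ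
  have hφt : ∀ u ∈ ψ.target, φ u = ψ.symm u := fun u hu => Set.piecewise_eq_of_mem _ _ _ hu
  have hφm : Measurable φ := ψ.continuousOn_symm.measurable_piecewise continuousOn_const
    ψ.open_target.measurableSet
  -- Restricting the density to the parameters of a small ball makes `norm_le` hold everywhere.
  set W : Set (EuclideanSpace ℝ (Fin m)) := ψ.target ∩ φ ⁻¹' closedBall x δ with hW
  have hWm : MeasurableSet W := ψ.open_target.measurableSet.inter (hφm measurableSet_closedBall)
  have hφev : φ =ᶠ[𝓝 a] ψ.symm := by
    filter_upwards [ψ.open_target.mem_nhds ha] with u hu using hφt u hu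
  have hWn : W ∈ 𝓝 a := by
    refine inter_mem (ψ.open_target.mem_nhds ha) ?_
    have hc : ContinuousAt φ a := (ψ.continuousAt_symm ha).congr hφev.symm
    refine hc.preimage_mem_nhds ?_
    rw [hφt a ha]
    exact closedBall_mem_nhds _ hδ
  have hder' : HasFDerivAt (fun u => j (φ u)) L a :=
    hder.congr_of_eventuallyEq (hφev.mono fun u hu => by simp [hu])
  have hψm : AEMeasurable ψ (μ.restrict ψ.source) :=
    ψ.continuousOn.aemeasurable ψ.open_source.measurableSet
  refine ⟨{
    param := φ
    dens := W.indicator g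
    center := a
    lin := T
    val := g a
    bound := C
    radius := δ
    measurable_param := hφm
    measurable_dens := hg.indicator hWm
    val_pos := hpos
    bound_pos := hC
    radius_pos := hδ
    param_center := hφt a ha
    restrict_eq := ?_
    norm_le := ?_
    tendsto_dist := ?_
    tendsto_dens := ?_ }⟩
  · have h1 : (fun u => ((W.indicator g u : ℝ≥0) : ℝ≥0∞)) = W.indicator fun u => (g u : ℝ≥0∞) := by
      ext u
      by_cases h : u ∈ W <;> simp [h]
    rw [h1, withDensity_indicator hWm, ← restrict_withDensity hWm, ← hlaw]
    ext A hA
    rw [Measure.map_apply hφm hA, Measure.restrict_apply (hφm hA),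
      Measure.map_apply_of_aemeasurable hψm ((hφm hA).inter hWm),
      Measure.restrict_apply' ψ.open_source.measurableSet, Measure.restrict_apply hA]
    congr 1
    ext y
    have hys : ∀ y ∈ ψ.source, φ (ψ y) = y := fun y hy => by
      rw [hφt _ (ψ.map_source hy), ψ.left_inv hy]
    constructor
    · rintro ⟨hyA, hyB⟩
      have hy := (hδU hyB).1
      refine ⟨⟨?_, ψ.map_source hy, ?_⟩, hy⟩
      · rwa [Set.mem_preimage, hys y hy]
      · rwa [Set.mem_preimage, hys y hy]
    · rintro ⟨⟨hyA, -, hyB⟩, hy⟩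
      rw [Set.mem_preimage, hys y hy] at hyA hyB
      exact ⟨hyA, hyB⟩
  · intro u hu
    have huW : u ∈ W := by
      by_contra h
      exact hu (Set.indicator_of_notMem h _)
    have h1 := (hδU huW.2).2
    simp only [Set.mem_preimage, Set.mem_ofPred_eq, hφt u huW.1, ψ.right_inv huW.1,
      Function.comp_apply, hj.dist_eq] at h1
    rw [hφt u huW.1]
    exact h1
  · intro u w
    have := hder'.tendsto_dist_div u w
    simp only [hj.dist_eq] at this
    rwa [← map_sub, hT, map_sub]
  · intro ρ
    obtain ⟨r, hr, hrW⟩ := nhds_basis_closedBall.mem_iff.1 hWn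
    refine (hleb ρ).congr' ?_
    have hsmall : ∀ᶠ ε : ℝ in 𝓝[>] 0, ε * ρ ≤ r := by
      have : Tendsto (fun ε : ℝ => ε * ρ) (𝓝 0) (𝓝 (0 * ρ)) := tendsto_id.mul_const ρ
      rw [zero_mul] at this
      exact (this.mono_left nhdsWithin_le_nhds).eventually_le_const hr
    filter_upwards [hsmall, self_mem_nhdsWithin] with ε hε (hε0 : 0 < ε)
    refine setLIntegral_congr_fun measurableSet_closedBall fun u hu => ?_
    have : a + ε • u ∈ W := by
      apply hrW
      rw [mem_closedBall_iff_norm, add_sub_cancel_left, norm_smul, Real.norm_of_nonneg hε0.le]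
      exact (mul_le_mul_of_nonneg_left (mem_closedBall_zero_iff.1 hu) hε0.le).trans hε
    simp only [Set.indicator_of_mem this]

/-- Almost every point in the domain of a suitable chart has a local model. -/
lemma ae_nonempty_localModel_of_chart [Nontrivial (EuclideanSpace ℝ (Fin m))]
    {j : S → E} (hj : Isometry j)
    (ψ : OpenPartialHomeomorph S (EuclideanSpace ℝ (Fin m)))
    (hac : Measure.map ψ (μ.restrict ψ.source) ≪ volume.restrict ψ.target)
    (hder : ∀ a ∈ ψ.target, ∃ L : EuclideanSpace ℝ (Fin m) →L[ℝ] E, Function.Injective L ∧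
      HasFDerivAt (j ∘ ψ.symm) L a) :
    ∀ᵐ y ∂(μ.restrict ψ.source), Nonempty (LocalModel (EuclideanSpace ℝ (Fin m)) μ y) := by
  set ν := Measure.map ψ (μ.restrict ψ.source) with hν
  have hac' : ν ≪ volume := hac.trans Measure.absolutelyContinuous_restrict
  set g : EuclideanSpace ℝ (Fin m) → ℝ≥0 := fun u => (ν.rnDeriv volume u).toNNReal
  have hg : Measurable g := (Measure.measurable_rnDeriv ν volume).ennreal_toNNReal
  have hlaw : ν = volume.withDensity fun u => (g u : ℝ≥0∞) := by
    rw [← Measure.withDensity_rnDeriv_eq ν volume hac']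
    refine withDensity_congr_ae ?_
    filter_upwards [Measure.rnDeriv_lt_top ν volume] with u hu
    exact (ENNReal.coe_toNNReal hu.ne).symm
  have hfin : ∫⁻ u, g u ≠ ⊤ := by
    have : ν Set.univ ≠ ⊤ := measure_ne_top ν _
    rwa [hlaw, withDensity_apply _ MeasurableSet.univ, setLIntegral_univ] at this
  have hψm : AEMeasurable ψ (μ.restrict ψ.source) :=
    ψ.continuousOn.aemeasurable ψ.open_source.measurableSet
  have h1 := hac'.ae_le (ae_tendsto_lintegral_edist_rescaled hg hfin)
  have h2 : ∀ᵐ a ∂ν, 0 < g a := by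
    rw [hlaw, ae_withDensity_iff (by fun_prop)]
    refine ae_of_all _ fun a ha => ?_
    exact pos_iff_ne_zero.2 fun h => ha (by rw [h]; rfl)
  have h3 := ae_of_ae_map hψm h1
  have h4 := ae_of_ae_map hψm h2
  filter_upwards [h3, h4, ae_restrict_mem ψ.open_source.measurableSet] with y hy1 hy2 hy
  obtain ⟨L, hL, hd⟩ := hder _ (ψ.map_source hy)
  have := nonempty_localModel_of_chart hj ψ hg hlaw (ψ.map_source hy) hy2 hL hd hy1
  rwa [ψ.left_inv hy] at this

end Charts

/-! ### Submanifolds -/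

/-- In the chart that an immersion provides on its domain, the immersion is differentiable with an
injective derivative: up to the inverse of a chart of the codomain, it is `u ↦ (u, 0)`. -/
lemma Manifold.IsImmersionAt.exists_hasFDerivAt {m d : ℕ} {M : Type*} [TopologicalSpace M]
    [ChartedSpace (EuclideanSpace ℝ (Fin m)) M]
    {f : M → EuclideanSpace ℝ (Fin d)} {y : M}
    (h : IsImmersionAt (𝓡 m) 𝓘(ℝ, EuclideanSpace ℝ (Fin d)) ∞ f y)
    {a : EuclideanSpace ℝ (Fin m)} (ha : a ∈ h.domChart.target) :
    ∃ L : EuclideanSpace ℝ (Fin m) →L[ℝ] EuclideanSpace ℝ (Fin d), Function.Injective L ∧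
      HasFDerivAt (f ∘ h.domChart.symm) L a := by
  set ψ := h.domChart
  set χ := h.codChart
  set ι := h.equiv
  have hchart : ∀ u ∈ ψ.target, χ (f (ψ.symm u)) = ι (u, 0) := by
    intro u hu
    have hu' : u ∈ (ψ.extend (𝓡 m)).target := by simpa using hu
    simpa using h.writtenInCharts hu'
  have hsrc : ∀ u ∈ ψ.target, f (ψ.symm u) ∈ χ.source := fun u hu =>
    h.source_subset_preimage_source (ψ.map_target hu)
  have hmem : ∀ᶠ u in 𝓝 a, u ∈ ψ.target := ψ.open_target.mem_nhds ha
  have hχ : ContDiffOn ℝ ∞ χ χ.source :=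
    contMDiffOn_iff_contDiffOn.1 (contMDiffOn_of_mem_maximalAtlas h.codChart_mem_maximalAtlas)
  have hχs : ContDiffOn ℝ ∞ χ.symm χ.target :=
    contMDiffOn_iff_contDiffOn.1 (contMDiffOn_symm_of_mem_maximalAtlas h.codChart_mem_maximalAtlas)
  have hι : ι (a, 0) ∈ χ.target := by
    rw [← hchart a ha]; exact χ.map_source (hsrc a ha)
  have hd2 : DifferentiableAt ℝ χ.symm (ι (a, 0)) :=
    (hχs.contDiffAt (χ.open_target.mem_nhds hι)).differentiableAt (by simp)
  have hd1 : DifferentiableAt ℝ χ (f (ψ.symm a)) :=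
    (hχ.contDiffAt (χ.open_source.mem_nhds (hsrc a ha))).differentiableAt (by simp)
  set A : EuclideanSpace ℝ (Fin m) →L[ℝ] EuclideanSpace ℝ (Fin d) :=
    (ι : (EuclideanSpace ℝ (Fin m) × h.complement) →L[ℝ] EuclideanSpace ℝ (Fin d)).comp
      (ContinuousLinearMap.inl ℝ (EuclideanSpace ℝ (Fin m)) h.complement)
  have hinc : HasFDerivAt (fun u : EuclideanSpace ℝ (Fin m) => ι (u, 0)) A a := A.hasFDerivAt
  have hf : HasFDerivAt (f ∘ ψ.symm) ((fderiv ℝ χ.symm (ι (a, 0))).comp A) a := by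
    refine (hd2.hasFDerivAt.comp a hinc).congr_of_eventuallyEq ?_
    filter_upwards [hmem] with u hu
    simp only [Function.comp_apply, ← hchart u hu, χ.left_inv (hsrc u hu)]
  refine ⟨_, ?_, hf⟩
  -- Composed with the chart of the codomain, the derivative becomes the derivative of `u ↦ (u, 0)`.
  have hcomp := (hd1.hasFDerivAt.comp a hf).congr_of_eventuallyEq
    (f₁ := fun u => ι (u, 0)) (by
      filter_upwards [hmem] with u hu
      simp only [Function.comp_apply, hchart u hu])
  have heq := hcomp.unique hinc
  have hinj : Function.Injective A := by
    intro u v huv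
    have := ι.injective huv
    exact congrArg Prod.fst this
  rw [← heq] at hinj
  exact Function.Injective.of_comp hinj

/-- Almost every point of an embedded submanifold has a local model. -/
lemma AbsContInCharts.ae_nonempty_localModel {m d : ℕ} [Nontrivial (EuclideanSpace ℝ (Fin m))]
    {M : Set (EuclideanSpace ℝ (Fin d))} [ChartedSpace (EuclideanSpace ℝ (Fin m)) M]
    (hM : IsImmersion (𝓡 m) 𝓘(ℝ, EuclideanSpace ℝ (Fin d)) ∞
      (Subtype.val : M → EuclideanSpace ℝ (Fin d)))
    {μ : Measure M} [IsFiniteMeasure μ] (hac : AbsContInCharts (m := m) μ) :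
    ∀ᵐ y ∂μ, Nonempty (LocalModel (EuclideanSpace ℝ (Fin m)) μ y) := by
  rw [ae_iff]
  refine measure_null_of_locally_null _ fun y _ => ?_
  have h := hM.isImmersionAt y
  set ψ := h.domChart
  refine ⟨{y | ¬Nonempty (LocalModel (EuclideanSpace ℝ (Fin m)) μ y)} ∩ ψ.source,
    inter_mem self_mem_nhdsWithin
      (mem_nhdsWithin_of_mem_nhds (ψ.open_source.mem_nhds h.mem_domChart_source)), ?_⟩
  rw [← Measure.restrict_apply' ψ.open_source.measurableSet, ← ae_iff]
  exact ae_nonempty_localModel_of_chart isometry_subtype_coe ψ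
    (hac ψ h.domChart_mem_maximalAtlas) fun a ha => h.exists_hasFDerivAt ha

lemma tripleIntegrand_nonneg {m : ℕ} (w : EuclideanSpace ℝ (Fin m) × EuclideanSpace ℝ (Fin m)) :
    0 ≤ tripleIntegrand m w :=
  (Real.exp_pos _).le

lemma integrableOn_tripleIntegrand {m : ℕ} (h : tripleLConst m < ⊤) :
    IntegrableOn (tripleIntegrand m) (tripleRegion m) := by
  refine ⟨(measurable_tripleIntegrand m).aestronglyMeasurable, ?_⟩
  rw [hasFiniteIntegral_iff_ofReal (ae_of_all _ tripleIntegrand_nonneg)]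
  exact h

lemma tripleConst_eq_toReal (m : ℕ) : tripleConst m = (tripleLConst m).toReal :=
  integral_eq_lintegral_of_nonneg_ae (ae_of_all _ tripleIntegrand_nonneg)
    (measurable_tripleIntegrand m).aestronglyMeasurable

theorem lemmao
    (m d : ℕ) (hm : 1 ≤ m) (hmd : m ≤ d)
    -- an embedded `m`-dimensional smooth submanifold `M` of `ℝ^d`
    (M : Set (EuclideanSpace ℝ (Fin d)))
    [ChartedSpace (EuclideanSpace ℝ (Fin m)) M] [IsManifold (𝓡 m) ∞ M]
    (hM : IsSmoothEmbedding (𝓡 m) 𝓘(ℝ, EuclideanSpace ℝ (Fin d)) ∞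
      (Subtype.val : M → EuclideanSpace ℝ (Fin d)))
    -- i.i.d. random points of `M` with a law that is absolutely continuous in charts
    {Ω : Type*} [MeasurableSpace Ω] (P : Measure Ω) [IsProbabilityMeasure P]
    (X : ℕ → Ω → M) (hX : ∀ i, Measurable (X i))
    (hindep : iIndepFun X P) (hident : ∀ i, IdentDistrib (X i) (X 0) P P)
    (hac : AbsContInCharts (m := m) (Measure.map (X 0) P))
    -- `N n s i` is the index of the nearest neighbour of the `i`-th of the first `n` points,
    -- ties being broken in an arbitrary measurable way
    (N : (n : ℕ) → Ω → Fin n → Fin n) (hNmeas : ∀ n, Measurable (N n))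
    (hN : ∀ n, 2 ≤ n → ∀ s i,
      IsNearestNeighbor (fun l : Fin n => (X l s : EuclideanSpace ℝ (Fin d))) i (N n s i)) :
    IntegrableOn (tripleIntegrand m) (tripleRegion m) ∧
    Tendsto (fun n : ℕ => ∫ s, (1 / (n : ℝ)) * (numTriples (N n s) : ℝ) ∂P) atTop
      (𝓝 (tripleConst m)) := by
  have : Nonempty (Fin m) := ⟨⟨0, hm⟩⟩
  have : Nontrivial (EuclideanSpace ℝ (Fin m)) :=
    Module.nontrivial_of_finrank_pos (R := ℝ) (by simpa using Nat.pos_of_ne_zero (by omega))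
  have : IsProbabilityMeasure (Measure.map (X 0) P) :=
    Measure.isProbabilityMeasure_map (hX 0).aemeasurable
  obtain ⟨K, hK⟩ := exists_hasKissingBound M
  have hreg := hac.ae_nonempty_localModel hM.isImmersion
  have hfin := tripleLConst_lt_top hK hreg
  refine ⟨integrableOn_tripleIntegrand hfin, ?_⟩
  rw [← tendsto_add_atTop_iff_nat 3, tripleConst_eq_toReal]
  have hlim := tendsto_lintegral_numTriples hK hreg hX hindep (fun i => (hident i).map_eq)
    (T := fun k => N (k + 3)) fun k s i => hN (k + 3) (by omega) s i
  refine ((ENNReal.tendsto_toReal hfin.ne).comp hlim).congr fun k => ?_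
  have hmeas : Measurable fun s => (numTriples (N (k + 3) s) : ℝ) :=
    (measurable_of_countable fun T : Fin (k + 3) → Fin (k + 3) => (numTriples T : ℝ)).comp
      (hNmeas (k + 3))
  rw [integral_const_mul, integral_eq_lintegral_of_nonneg_ae
    (ae_of_all _ fun s => Nat.cast_nonneg _) hmeas.aestronglyMeasurable]
  simp only [Function.comp_apply, ENNReal.toReal_mul, ENNReal.ofReal_natCast, ENNReal.toReal_inv]
  congr 1
  rw [ENNReal.toReal_add (by simp) (by simp)]
  simp
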